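/- Let $1\le q<\infty$, and let $\psi:[0,\infty)\to[0,\infty)$ be a nondecreasing concave function with $\psi(0)=0$ and $\psi(t)>0$ for $t>0$. Let $m$ be Lebesgue measure on $(0,\infty)$. For a measurable $x:(0,\infty)\to\mathbb R$ let $x^*(t)=\inf\{\tau\ge 0: m\{s>0:|x(s)|>\tau\}\le t\}$, $t\ge0$, be its nonincreasing rearrangement. The Lorentz space $\Lambda_q(\psi)$ consists of all (classes of) measurable $x$ with $$\|x\|_{\Lambda_q(\psi)}=\Big(\int_{[0,\infty)}x^*(t)^q\,d\psi(t)\Big)^{1/q}<\infty ,$$ where $d\psi$ is the Lebesgue--Stieltjes measure of $\psi$ (with an atom of mass $\psi(0+)$ at $0$ if $\psi(0+)>0$). For $p\in[1,\infty]$, write $p\in\mathcal F(\Lambda_q(\psi))$ if for every $n\in\mathbb N$ and $\varepsilon>0$ there are functions $x_1,\dots,x_n\in \Lambda_q(\psi)$ that are pairwise disjointly supported and equimeasurable (that is, $m\{|x_i|>\tau\}=m\{|x_j|>\tau\}$ for all $\tau>0$ and all $i,j$) such that $$(1+\varepsilon)^{-1}\|a\|_{p}\le\Big\|\sum_{k=1}^n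 a_kx_k\Big\|_{\Lambda_q(\psi)}\le(1+\varepsilon)\|a\|_{p}\qquad\text{for all } a=(a_k)_{k=1}^n\in\mathbb R^n ,$$ where $\|a\|_p$ is the $\ell^p$-norm. Put $$\alpha_{\psi,q}=-\lim_{n\to\infty}\frac1n\log_2\sup_{k\in\mathbb Z}\Big(\frac{\psi(2^k)}{\psi(2^{n+k})}\Big)^{1/q},\qquad \beta_{\psi,q}=\lim_{n\to\infty}\frac1n\log_2\sup_{k\in\mathbb Z}\Big(\frac{\psi(2^{n+k})}{\psi(2^{k})}\Big)^{1/q},$$ $$\alpha^\infty_{\psi,q}=-\lim_{n\to\infty}\frac1n\log_2\sup_{k\ge0}\Big(\frac{\psi(2^k)}{\psi(2^{k+n})}\Big)^{1/q},\qquad \beta^0_{\psi,q}=\lim_{n\to\infty}\frac1n\log_2\sup_{k\le0}\Big(\frac{\psi(2^{k})}{\psi(2^{k-n})}\Big)^{1/q}.$$ These limits exist and are nonnegative, and, with the convention $1/0=\infty$ and with intervals taken in $[0,\infty]$: (i) if $\alpha^\infty_{\psi,q}\le\beta^0_{\psi,q}$, then $\mathcal F(\Lambda_q(\psi))=[1/\beta_{\psi,q},\,1/\alpha_{\psi,q}]$;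 (ii) if $\alpha^\infty_{\psi,q}>\beta^0_{\psi,q}$, then $\mathcal F(\Lambda_q(\psi))=[1/\beta_{\psi,q},\,1/\alpha^\infty_{\psi,q}]\cup[1/\beta^0_{\psi,q},\,1/\alpha_{\psi,q}]$. -/

import Mathlib

open MeasureTheory Set Filter Topology
open scoped ENNReal

/-! ### Rearrangements and symmetric finite representability on `(0, ∞)` -/

/-- The distribution function `τ ↦ m {s > 0 : |x s| > τ}` of a function on `(0, ∞)`.
Functions on `(0, ∞)` are represented by functions `ℝ → ℝ`, whose values outside `(0, ∞)` are
never used. -/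
noncomputable def distribFun (x : ℝ → ℝ) (τ : ℝ≥0∞) : ℝ≥0∞ :=
  volume {s : ℝ | 0 < s ∧ τ < ENNReal.ofReal |x s|}

/-- The right-continuous nonincreasing rearrangement
`x* t = inf {τ ≥ 0 : m {s > 0 : |x s| > τ} ≤ t}`, with `inf ∅ = ∞`
(for `t = 0` this is the essential supremum of `|x|`). -/
noncomputable def rearrangement (x : ℝ → ℝ) (t : ℝ) : ℝ≥0∞ :=
  sInf {τ : ℝ≥0∞ | distribFun x τ ≤ ENNReal.ofReal t}

/-- `x` and `y` are equimeasurable on `(0, ∞)`. -/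
def Equimeasurable (x y : ℝ → ℝ) : Prop :=
  ∀ τ : ℝ, 0 < τ → volume {s : ℝ | 0 < s ∧ τ < |x s|} = volume {s : ℝ | 0 < s ∧ τ < |y s|}

/-- `x` and `y` have disjoint supports in `(0, ∞)`, up to a null set. -/
def DisjointSupports (x y : ℝ → ℝ) : Prop :=
  ∀ᵐ t ∂(volume.restrict (Ioi (0 : ℝ))), x t = 0 ∨ y t = 0

/-- The space of measurable functions on `(0, ∞)` on which the functional `N` is finite. -/
def functionSpace (N : (ℝ → ℝ) → ℝ≥0∞) : Set (ℝ → ℝ) :=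
  {x | AEMeasurable x (volume.restrict (Ioi (0 : ℝ))) ∧ N x < ∞}

/-- `ℓ^p` is symmetrically finitely represented in the function space with norm `N`. -/
def SymmFinitelyRepresented (N : (ℝ → ℝ) → ℝ≥0∞) (p : ℝ≥0∞) : Prop :=
  ∀ (n : ℕ) (ε : ℝ), 0 < ε → ∃ x : Fin n → ℝ → ℝ,
    (∀ k, x k ∈ functionSpace N) ∧
    (∀ i j, Equimeasurable (x i) (x j)) ∧
    (∀ i j, i ≠ j → DisjointSupports (x i) (x j)) ∧
    ∀ a : Fin n → ℝ,
      ENNReal.ofReal ((1 + ε)⁻¹ * ‖(WithLp.toLp p a : PiLp p fun _ : Fin n => ℝ)‖)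
          ≤ N (fun t => ∑ k, a k * x k t) ∧
        N (fun t => ∑ k, a k * x k t)
          ≤ ENNReal.ofReal ((1 + ε) * ‖(WithLp.toLp p a : PiLp p fun _ : Fin n => ℝ)‖)

/-- The set `F(X)` of all `p ∈ [1, ∞]` such that `ℓ^p` is symmetrically finitely represented
in the function space `X` with norm `N`. -/
def symmRepSet (N : (ℝ → ℝ) → ℝ≥0∞) : Set ℝ≥0∞ :=
  {p | 1 ≤ p ∧ SymmFinitelyRepresented N p}

/-! ### Lorentz spaces -/

theorem monotone_extend_of_monotoneOn {ψ : ℝ → ℝ} (hψ : MonotoneOn ψ (Ici 0)) :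
    Monotone fun t : ℝ => ψ (max t 0) := fun _ _ h =>
  hψ (mem_Ici.2 (le_max_right _ _)) (mem_Ici.2 (le_max_right _ _)) (max_le_max_right 0 h)

/-- The Lebesgue-Stieltjes measure `dψ` of a nondecreasing function `ψ` on `[0, ∞)`, as a measure
on `ℝ` concentrated on `[0, ∞)`. The function is extended by the constant `ψ 0` to the left, so
that the measure has the atom `ψ(0+) - ψ(0)` at `0`. -/
noncomputable def dPsi (ψ : ℝ → ℝ) (hψ : MonotoneOn ψ (Ici 0)) : Measure ℝ :=
  (monotone_extend_of_monotoneOn hψ).stieltjesFunction.measure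

/-- The norm `(∫_{[0, ∞)} (x* t)^q dψ(t))^{1/q}` of the Lorentz space `Λ_q(ψ)`. -/
noncomputable def lorentzNorm (q : ℝ) (ψ : ℝ → ℝ) (hψ : MonotoneOn ψ (Ici 0))
    (x : ℝ → ℝ) : ℝ≥0∞ :=
  (∫⁻ t in Ici (0 : ℝ), rearrangement x t ^ q ∂(dPsi ψ hψ)) ^ (1 / q)

/-! ### Dilation indices of `ψ ^ (1 / q)`

For each index, the sequence whose limit it is, and the limit itself. -/

noncomputable def alphaSeq (q : ℝ) (ψ : ℝ → ℝ) (n : ℕ) : ℝ :=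
  -(1 / (n : ℝ) *
    Real.logb 2 (⨆ k : ℤ, (ψ ((2 : ℝ) ^ k) / ψ ((2 : ℝ) ^ (n + k))) ^ (1 / q)))

noncomputable def betaSeq (q : ℝ) (ψ : ℝ → ℝ) (n : ℕ) : ℝ :=
  1 / (n : ℝ) *
    Real.logb 2 (⨆ k : ℤ, (ψ ((2 : ℝ) ^ (n + k)) / ψ ((2 : ℝ) ^ k)) ^ (1 / q))

noncomputable def alphaInfSeq (q : ℝ) (ψ : ℝ → ℝ) (n : ℕ) : ℝ :=
  -(1 / (n : ℝ) *
    Real.logb 2 (⨆ k : {k : ℤ // 0 ≤ k},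
      (ψ ((2 : ℝ) ^ (k : ℤ)) / ψ ((2 : ℝ) ^ ((k : ℤ) + n))) ^ (1 / q)))

noncomputable def betaZeroSeq (q : ℝ) (ψ : ℝ → ℝ) (n : ℕ) : ℝ :=
  1 / (n : ℝ) *
    Real.logb 2 (⨆ k : {k : ℤ // k ≤ 0},
      (ψ ((2 : ℝ) ^ (k : ℤ)) / ψ ((2 : ℝ) ^ ((k : ℤ) - n))) ^ (1 / q))

/-- `α_{ψ,q}` -/
noncomputable def alphaIdx (q : ℝ) (ψ : ℝ → ℝ) : ℝ := limUnder atTop (alphaSeq q ψ)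

/-- `β_{ψ,q}` -/
noncomputable def betaIdx (q : ℝ) (ψ : ℝ → ℝ) : ℝ := limUnder atTop (betaSeq q ψ)

/-- `α^∞_{ψ,q}` -/
noncomputable def alphaInfIdx (q : ℝ) (ψ : ℝ → ℝ) : ℝ := limUnder atTop (alphaInfSeq q ψ)

/-- `β^0_{ψ,q}` -/
noncomputable def betaZeroIdx (q : ℝ) (ψ : ℝ → ℝ) : ℝ := limUnder atTop (betaZeroSeq q ψ)

/-- `1 / a ∈ [0, ∞]` for an index `a ≥ 0`, with `1 / 0 = ∞`. -/
noncomputable def recipIdx (a : ℝ) : ℝ≥0∞ := (ENNReal.ofReal a)⁻¹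

/-!
Let `W k = ψ (2 ^ k)` and `γ = q / p`. The space `ℓ^p` fails to be represented exactly when `ℤ`
is the union of two sets such that `W k * 2 ^ (-γ k)` grows exponentially to the right from the
points of one of them and exponentially to the left from the points of the other. For `p` outside
`[1 / β, 1 / α]` one of these sets may be taken to be empty; in the gap of case (ii) they are two
half-lines.

*Necessity.* If the integers split in this way, then for every `ε > 0` and a suitable `m`,
`W (k + m) ≤ ε 2 ^ (γ m) W k + ε 2 ^ (-γ m) W (k + 2 m)` for all `k`. The `q`-th power of the norm
of a sum of `n` disjoint copies of `x` is the integral of `ψ (n H τ)` with respect to `d(τ ^ q)`,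
where `H` is the distribution function of `x`. Integrating the inequality shows that the sums of
`2 ^ m` copies are too small in comparison with those of `1` and of `2 ^ (2 m)` copies.

*Sufficiency.* If the integers do not split, there are intervals of `ℤ` on which the sum of
`W k * 2 ^ (-γ k)` is arbitrarily large in comparison with its terms at the ends. For `p < ∞` let
`f` be `t ^ (-1 / p)`, truncated to the corresponding range of `t`. Since `a * f` has, apart from
the ends, the distribution function of `f` multiplied by `|a| ^ p`, a combination of disjoint
copies of `f` with coefficients `a_k` has, apart from the ends, that of `‖a‖_p * f`. For `p = ∞`
the copies of the indicator of a set on whose scale `ψ` is almost constant take the place of `f`.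
-/

/-! ### Growth of two-sided sequences -/

/-- The reflection `k ↦ W (-k)` of a two-sided sequence. -/
def reflect (W : ℤ → ℝ) (k : ℤ) : ℝ := W (-k)

/-- The exponential tilt `k ↦ 2 ^ (-γ k) W k`, which lowers every growth rate of `W` by `γ`. -/
noncomputable def tilt (γ : ℝ) (W : ℤ → ℝ) (k : ℤ) : ℝ := 2 ^ (-(γ * k)) * W k

/-- A positive two-sided sequence whose neighbouring terms differ by a factor of at most `B`. -/
structure HasRatioBound (B : ℝ) (W : ℤ → ℝ) : Prop where
  pos : ∀ k, 0 < W k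
  succ_le : ∀ k, W (k + 1) ≤ B * W k
  le_succ : ∀ k, W k ≤ B * W (k + 1)

/-- Along the steps to the right from points of `K`, the sequence `W` grows at least like
`2 ^ (δ n)`, up to a constant factor. -/
def GrowsAtRate (W : ℤ → ℝ) (K : Set ℤ) (δ : ℝ) : Prop :=
  ∃ c > 0, ∀ k ∈ K, ∀ n : ℕ, c * 2 ^ (δ * n) * W k ≤ W (k + n)

/-- The supremum of the exponential rates at which `W` grows to the right from points of `K`. -/
noncomputable def growthRate (W : ℤ → ℝ) (K : Set ℤ) : ℝ := sSup {δ | GrowsAtRate W K δ}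

theorem reflect_reflect (W : ℤ → ℝ) : reflect (reflect W) = W := by
  ext k
  simp [reflect]

theorem reflect_tilt (γ : ℝ) (W : ℤ → ℝ) : reflect (tilt γ W) = tilt (-γ) (reflect W) := by
  ext k
  simp [reflect, tilt]

theorem le_of_forall_mul_pow_le {c x y : ℝ} (hc : 0 < c) (hy : 0 < y)
    (h : ∀ n : ℕ, c * x ^ n ≤ y ^ n) : x ≤ y := by
  by_contra! hxy
  obtain ⟨n, hn⟩ := pow_unbounded_of_one_lt c⁻¹ ((one_lt_div hy).2 hxy)
  rw [div_pow, lt_div_iff₀ (by positivity), inv_mul_lt_iff₀ hc] at hn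
  exact (h n).not_gt hn

namespace HasRatioBound

variable {B : ℝ} {W : ℤ → ℝ}

theorem one_le (hW : HasRatioBound B W) : 1 ≤ B := by
  have hB : 0 < B := pos_of_mul_pos_left ((hW.pos _).trans_le (hW.succ_le 0)) (hW.pos 0).le
  have h := (hW.succ_le 0).trans (mul_le_mul_of_nonneg_left (hW.le_succ 0) hB.le)
  rw [← mul_assoc, le_mul_iff_one_le_left (hW.pos _)] at h
  exact (one_le_sq_iff₀ hB.le).1 (h.trans_eq (sq B).symm)

theorem add_natCast_le (hW : HasRatioBound B W) (k : ℤ) (n : ℕ) : W (k + n) ≤ B ^ n * W k := by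
  induction n with
  | zero => simp
  | succ n ih =>
    have hB : 0 ≤ B := zero_le_one.trans hW.one_le
    calc W (k + (n + 1 : ℕ)) = W (k + n + 1) := by push_cast; ring_nf
      _ ≤ B * W (k + n) := hW.succ_le _
      _ ≤ B * (B ^ n * W k) := by gcongr
      _ = B ^ (n + 1) * W k := by ring

theorem reflect (hW : HasRatioBound B W) : HasRatioBound B (reflect W) where
  pos k := hW.pos _
  succ_le k := by simpa [_root_.reflect] using hW.le_succ (-(k + 1))
  le_succ k := by simpa [_root_.reflect] using hW.succ_le (-(k + 1))

theorem le_add_natCast (hW : HasRatioBound B W) (k : ℤ) (n : ℕ) : W k ≤ B ^ n * W (k + n) := by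
  simpa [_root_.reflect] using hW.reflect.add_natCast_le (-(k + n)) n

theorem tilt (hW : HasRatioBound B W) (γ : ℝ) :
    HasRatioBound (2 ^ |γ| * B) (tilt γ W) where
  pos k := mul_pos (by positivity) (hW.pos k)
  succ_le k := by
    have hγ : (2 : ℝ) ^ (-(γ * (k + 1 : ℤ))) ≤ 2 ^ |γ| * 2 ^ (-(γ * k)) := by
      rw [← Real.rpow_add two_pos]
      refine Real.rpow_le_rpow_of_exponent_le one_le_two ?_
      push_cast
      linarith [neg_abs_le γ]
    calc _ ≤ 2 ^ |γ| * 2 ^ (-(γ * k)) * (B * W k) :=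
          mul_le_mul hγ (hW.succ_le k) (hW.pos _).le (by positivity)
      _ = _ := by rw [_root_.tilt]; ring
  le_succ k := by
    have hγ : (2 : ℝ) ^ (-(γ * k)) ≤ 2 ^ |γ| * 2 ^ (-(γ * (k + 1 : ℤ))) := by
      rw [← Real.rpow_add two_pos]
      refine Real.rpow_le_rpow_of_exponent_le one_le_two ?_
      push_cast
      linarith [le_abs_self γ]
    calc _ ≤ 2 ^ |γ| * 2 ^ (-(γ * (k + 1 : ℤ))) * (B * W (k + 1)) :=
          mul_le_mul hγ (hW.le_succ k) (hW.pos _).le (by positivity)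
      _ = _ := by rw [_root_.tilt]; ring

end HasRatioBound

namespace GrowsAtRate

variable {B γ δ : ℝ} {W : ℤ → ℝ} {K : Set ℤ}

theorem mono_set {L : Set ℤ} (h : GrowsAtRate W K δ) (hLK : L ⊆ K) : GrowsAtRate W L δ :=
  let ⟨c, hc, hg⟩ := h
  ⟨c, hc, fun k hk => hg k (hLK hk)⟩

theorem anti_rate {δ' : ℝ} (hW : ∀ k, 0 ≤ W k) (h : GrowsAtRate W K δ) (hδ : δ' ≤ δ) :
    GrowsAtRate W K δ' := by
  obtain ⟨c, hc, hg⟩ := h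
  refine ⟨c, hc, fun k hk n => le_trans ?_ (hg k hk n)⟩
  have := hW k
  gcongr
  exact one_le_two

theorem of_tilt (h : GrowsAtRate (tilt γ W) K δ) : GrowsAtRate W K (γ + δ) := by
  obtain ⟨c, hc, hg⟩ := h
  refine ⟨c, hc, fun k hk n => ?_⟩
  have hpow : (2 : ℝ) ^ (-(γ * (k + n : ℤ))) * 2 ^ (γ * n) = 2 ^ (-(γ * k)) := by
    rw [← Real.rpow_add two_pos]
    push_cast
    ring_nf
  refine le_of_mul_le_mul_left ?_ (Real.rpow_pos_of_pos two_pos (-(γ * (k + n : ℤ))))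
  calc _ = c * 2 ^ (δ * n) * (2 ^ (-(γ * (k + n : ℤ))) * 2 ^ (γ * n) * W k) := by
        rw [add_mul, Real.rpow_add two_pos]; ring
    _ = c * 2 ^ (δ * n) * tilt γ W k := by rw [hpow, tilt]
    _ ≤ tilt γ W (k + n) := hg k hk n

theorem of_step (hW : HasRatioBound B W) {N : ℕ} (hN : 0 < N) (hK : ∀ k ∈ K, k + (N : ℤ) ∈ K)
    (h : ∀ k ∈ K, 2 ^ (δ * N) * W k ≤ W (k + N)) : GrowsAtRate W K δ := by
  have hB : 0 < B := one_pos.trans_le hW.one_le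
  have hsteps : ∀ j : ℕ, ∀ k ∈ K, 2 ^ (δ * (N * j : ℕ)) * W k ≤ W (k + (N * j : ℕ)) := by
    intro j
    induction j with
    | zero => simp
    | succ j ih =>
      intro k hk
      calc _ = 2 ^ (δ * (N * j : ℕ)) * (2 ^ (δ * N) * W k) := by
            rw [← mul_assoc, ← Real.rpow_add two_pos]; push_cast; ring_nf
        _ ≤ 2 ^ (δ * (N * j : ℕ)) * W (k + N) := by gcongr; exact h k hk
        _ ≤ W (k + N + (N * j : ℕ)) := ih _ (hK k hk)
        _ = _ := by congr 1; push_cast; ring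
  refine ⟨(B ^ N * 2 ^ (|δ| * N))⁻¹, by positivity, fun k hk n => ?_⟩
  have hi : (n % N : ℕ) ≤ N := (Nat.mod_lt n hN).le
  have hpow : (2 : ℝ) ^ (δ * n) ≤ 2 ^ (|δ| * N) * 2 ^ (δ * (N * (n / N) : ℕ)) := by
    rw [← Real.rpow_add two_pos]
    refine Real.rpow_le_rpow_of_exponent_le one_le_two ?_
    have hδi : δ * (n % N : ℕ) ≤ |δ| * N := by gcongr; exact le_abs_self δ
    have hn : (n : ℝ) = (N * (n / N) : ℕ) + (n % N : ℕ) := mod_cast (Nat.div_add_mod n N).symm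
    rw [hn, mul_add]
    linarith
  rw [inv_mul_eq_div, div_mul_eq_mul_div, div_le_iff₀ (by positivity)]
  calc 2 ^ (δ * n) * W k ≤ 2 ^ (|δ| * N) * (2 ^ (δ * (N * (n / N) : ℕ)) * W k) := by
        rw [← mul_assoc]
        exact mul_le_mul_of_nonneg_right hpow (hW.pos k).le
    _ ≤ 2 ^ (|δ| * N) * W (k + (N * (n / N) : ℕ)) := by gcongr; exact hsteps _ k hk
    _ ≤ 2 ^ (|δ| * N) * (B ^ (n % N) * W (k + (N * (n / N) : ℕ) + (n % N : ℕ))) := by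
        gcongr; exact hW.le_add_natCast _ _
    _ = 2 ^ (|δ| * N) * (B ^ (n % N) * W (k + n)) := by
        rw [add_assoc, ← Nat.cast_add, Nat.div_add_mod]
    _ ≤ 2 ^ (|δ| * N) * (B ^ N * W (k + n)) := by
        have := hW.pos (k + n)
        gcongr
        exact hW.one_le
    _ = _ := by ring

theorem of_Ici (hW : HasRatioBound B W) {a : ℤ} (b : ℤ) (h : GrowsAtRate W (Ici a) δ) :
    GrowsAtRate W (Ici b) δ := by
  obtain ⟨c, hc, hg⟩ := h
  have hB : 0 < B := one_pos.trans_le hW.one_le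
  set m := (a - b).toNat
  refine ⟨c / (B ^ m * B ^ m), by positivity, fun k hk n => ?_⟩
  have hkm : k + m ∈ Ici a := by
    have := Int.self_le_toNat (a - b)
    simp only [mem_Ici, m] at hk ⊢
    lia
  rw [div_mul_eq_mul_div, div_mul_eq_mul_div, div_le_iff₀ (by positivity)]
  calc c * 2 ^ (δ * n) * W k ≤ c * 2 ^ (δ * n) * (B ^ m * W (k + m)) := by
        gcongr; exact hW.le_add_natCast k m
    _ = B ^ m * (c * 2 ^ (δ * n) * W (k + m)) := by ring
    _ ≤ B ^ m * W (k + m + n) := by gcongr; exact hg _ hkm n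
    _ = B ^ m * W (k + n + m) := by rw [add_right_comm]
    _ ≤ B ^ m * (B ^ m * W (k + n)) := by gcongr; exact hW.add_natCast_le _ _
    _ = _ := by ring

theorem rpow_le {x : ℝ} {k : ℤ} (h : GrowsAtRate W K δ) (hk : k ∈ K) (hWk : 0 < W k)
    (hx : 0 < x) (hgrowth : ∀ n : ℕ, W (k + n) ≤ x ^ n * W k) : 2 ^ δ ≤ x := by
  obtain ⟨c, hc, hg⟩ := h
  refine le_of_forall_mul_pow_le hc hx fun n => ?_
  rw [← Real.rpow_mul_natCast zero_le_two]
  exact le_of_mul_le_mul_right ((hg k hk n).trans (hgrowth n)) hWk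

theorem neg_logb (hW : HasRatioBound B W) (K : Set ℤ) : GrowsAtRate W K (-Real.logb 2 B) := by
  have hB : 0 < B := one_pos.trans_le hW.one_le
  refine ⟨1, one_pos, fun k _ n => ?_⟩
  rw [Real.rpow_mul_natCast zero_le_two, Real.rpow_neg zero_le_two,
    Real.rpow_logb two_pos one_lt_two.ne' hB, one_mul, inv_pow, inv_mul_le_iff₀ (by positivity)]
  exact hW.le_add_natCast k n

end GrowsAtRate

section growthRate

variable {B δ : ℝ} {W : ℤ → ℝ} {K : Set ℤ}

theorem le_growthRate (hW : HasRatioBound B W) (hK : K.Nonempty) (h : GrowsAtRate W K δ) :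
    δ ≤ growthRate W K := by
  have hB : 0 < B := one_pos.trans_le hW.one_le
  obtain ⟨k, hk⟩ := hK
  refine le_csSup ⟨Real.logb 2 B, fun δ' hδ' => ?_⟩ h
  rw [Real.le_logb_iff_rpow_le one_lt_two hB]
  exact hδ'.rpow_le hk (hW.pos k) hB (hW.add_natCast_le k)

theorem growthRate_le (hW : HasRatioBound B W) (h : ∀ δ', GrowsAtRate W K δ' → δ' ≤ δ) :
    growthRate W K ≤ δ :=
  csSup_le ⟨_, .neg_logb hW K⟩ h

theorem growsAtRate_of_lt_growthRate (hW : HasRatioBound B W) (h : δ < growthRate W K) :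
    GrowsAtRate W K δ := by
  obtain ⟨δ', hδ', hlt⟩ := exists_lt_of_lt_csSup ⟨_, .neg_logb hW K⟩ h
  exact GrowsAtRate.anti_rate (fun k => (hW.pos k).le) hδ' hlt.le

theorem lt_growthRate_iff (hW : HasRatioBound B W) (hK : K.Nonempty) :
    δ < growthRate W K ↔ ∃ δ' > δ, GrowsAtRate W K δ' := by
  refine ⟨fun h => ?_, fun ⟨δ', hδ', h⟩ => hδ'.trans_le (le_growthRate hW hK h)⟩
  obtain ⟨δ', h₁, h₂⟩ := exists_between h
  exact ⟨δ', h₁, growsAtRate_of_lt_growthRate hW h₂⟩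

theorem growthRate_anti {L : Set ℤ} (hW : HasRatioBound B W) (hL : L.Nonempty) (h : L ⊆ K) :
    growthRate W K ≤ growthRate W L :=
  growthRate_le hW fun _ hδ => le_growthRate hW hL (hδ.mono_set h)

theorem growthRate_nonneg (hW : HasRatioBound B W) (hK : K.Nonempty) (hmono : Monotone W) :
    0 ≤ growthRate W K :=
  le_growthRate hW hK ⟨1, one_pos, fun k _ n => by simpa using hmono (show k ≤ k + n by lia)⟩

theorem growthRate_nonpos (hW : HasRatioBound B W) (hK : K.Nonempty) (hanti : Antitone W) :
    growthRate W K ≤ 0 := by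
  refine growthRate_le hW fun δ hδ => ?_
  obtain ⟨k, hk⟩ := hK
  have h : (2 : ℝ) ^ δ ≤ 1 := hδ.rpow_le hk (hW.pos k) one_pos fun n => by
    simpa using hanti (show k ≤ k + n by lia)
  rwa [← Real.rpow_zero 2, Real.rpow_le_rpow_left_iff one_lt_two] at h

end growthRate

/-- The integers split at the rate `γ` for `W`: on one part `W` grows to the right faster than
`2 ^ (γ n)`, on the other part it grows to the left faster than `2 ^ (-γ n)`. The second part is
recorded through its reflection `L`. -/
def IsSplitAt (W : ℤ → ℝ) (γ : ℝ) : Prop :=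
  ∃ K L : Set ℤ, (∀ k, k ∈ K ∨ -k ∈ L) ∧
    (∃ δ > γ, GrowsAtRate W K δ) ∧ ∃ δ > -γ, GrowsAtRate (reflect W) L δ

section split

variable {B γ δ₁ δ₂ : ℝ} {W : ℤ → ℝ} {K L : Set ℤ}

theorem GrowsAtRate.bddBelow_of_reflect (hpos : ∀ k, 0 < W k) (h₁ : GrowsAtRate W K δ₁)
    (h₂ : GrowsAtRate (reflect W) L δ₂) (hδ : 0 < δ₁ + δ₂) (hK : K.Nonempty) : BddBelow L := by
  obtain ⟨c₁, hc₁, h₁⟩ := h₁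
  obtain ⟨c₂, hc₂, h₂⟩ := h₂
  obtain ⟨k, hk⟩ := hK
  obtain ⟨N, hN⟩ := pow_unbounded_of_one_lt (c₁ * c₂)⁻¹
    (Real.one_lt_rpow one_lt_two hδ)
  refine ⟨-(k + N), fun l hl => ?_⟩
  by_contra! hlt
  obtain ⟨n, hn⟩ : ∃ n : ℕ, -l = k + n := ⟨(-l - k).toNat, by lia⟩
  have hright : c₁ * 2 ^ (δ₁ * n) * W k ≤ W (k + n) := h₁ k hk n
  have hleft : c₂ * 2 ^ (δ₂ * n) * W (k + n) ≤ W k := by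
    have := h₂ l hl n
    rwa [reflect, reflect, hn, show -(l + n) = k by lia] at this
  have hbound : c₁ * c₂ * (2 ^ (δ₁ + δ₂)) ^ n ≤ 1 := by
    refine le_of_mul_le_mul_right ?_ (hpos k)
    calc _ = c₂ * 2 ^ (δ₂ * n) * (c₁ * 2 ^ (δ₁ * n) * W k) := by
          rw [← Real.rpow_mul_natCast zero_le_two, add_mul, Real.rpow_add two_pos]; ring
      _ ≤ c₂ * 2 ^ (δ₂ * n) * W (k + n) := by gcongr
      _ ≤ 1 * W k := hleft.trans_eq (one_mul _).symm
  have hNn : (2 ^ (δ₁ + δ₂) : ℝ) ^ N ≤ (2 ^ (δ₁ + δ₂)) ^ n :=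
    pow_le_pow_right₀ (Real.one_le_rpow one_le_two hδ.le) (by lia)
  rw [inv_lt_iff_one_lt_mul₀ (by positivity)] at hN
  nlinarith [mul_pos hc₁ hc₂]

theorem GrowsAtRate.isSplitAt_of_Ici (h₁ : GrowsAtRate W (Ici 0) δ₁) (hδ₁ : γ < δ₁)
    (h₂ : GrowsAtRate (reflect W) (Ici 0) δ₂) (hδ₂ : -γ < δ₂) : IsSplitAt W γ :=
  ⟨Ici 0, Ici 0, fun k => by simpa using le_total 0 k, ⟨δ₁, hδ₁, h₁⟩, δ₂, hδ₂, h₂⟩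

theorem isSplitAt_iff (hW : HasRatioBound B W) :
    IsSplitAt W γ ↔ γ < growthRate W univ ∨ -γ < growthRate (reflect W) univ ∨
      γ < growthRate W (Ici 0) ∧ -γ < growthRate (reflect W) (Ici 0) := by
  rw [lt_growthRate_iff hW univ_nonempty, lt_growthRate_iff hW.reflect univ_nonempty,
    lt_growthRate_iff hW nonempty_Ici, lt_growthRate_iff hW.reflect nonempty_Ici]
  constructor
  · rintro ⟨K, L, hKL, ⟨δ₁, hδ₁, h₁⟩, δ₂, hδ₂, h₂⟩
    rcases K.eq_empty_or_nonempty with rfl | hK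
    · exact .inr (.inl ⟨δ₂, hδ₂, h₂.mono_set fun k _ => by simpa using hKL (-k)⟩)
    rcases L.eq_empty_or_nonempty with rfl | hL
    · exact .inl ⟨δ₁, hδ₁, h₁.mono_set fun k _ => by simpa using hKL k⟩
    obtain ⟨a, ha⟩ := h₁.bddBelow_of_reflect hW.pos h₂ (by linarith) hK
    obtain ⟨b, hb⟩ := h₂.bddBelow_of_reflect hW.reflect.pos (by rwa [reflect_reflect])
      (by linarith) hL
    refine .inr (.inr ⟨⟨δ₁, hδ₁, .of_Ici hW 0 (a := 1 - a) (h₁.mono_set fun k hk => ?_)⟩,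
      δ₂, hδ₂, .of_Ici hW.reflect 0 (a := 1 - b) (h₂.mono_set fun l hl => ?_)⟩)
    · exact (hKL k).resolve_right fun h => by have := ha h; rw [mem_Ici] at hk; lia
    · have hl' := hKL (-l)
      rw [neg_neg] at hl'
      exact hl'.resolve_left fun h => by have := hb h; rw [mem_Ici] at hl; lia
  · rintro (⟨δ₁, hδ₁, h₁⟩ | ⟨δ₂, hδ₂, h₂⟩ | ⟨⟨δ₁, hδ₁, h₁⟩, δ₂, hδ₂, h₂⟩)
    · exact ⟨univ, ∅, by simp, ⟨δ₁, hδ₁, h₁⟩, -γ + 1, by linarith, 1, one_pos, by simp⟩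
    · exact ⟨∅, univ, by simp, ⟨γ + 1, by linarith, 1, one_pos, by simp⟩, δ₂, hδ₂, h₂⟩
    · exact h₁.isSplitAt_of_Ici hδ₁ h₂ hδ₂

theorem HasRatioBound.mul_sum_symm_Ico_le (hW : HasRatioBound B W) {ε : ℝ} (hε : 0 ≤ ε)
    (h : ∀ a b : ℤ, a ≤ b → ε * ∑ i ∈ Finset.Ico a b, W i ≤ W a + W b) (k : ℤ) (j : ℕ) :
    (1 + ε / B) ^ j * W k ≤ ∑ i ∈ Finset.Ico (k - (j + 1 : ℕ)) (k + (j + 1 : ℕ)), W i := by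
  have hB : 0 < B := one_pos.trans_le hW.one_le
  induction j with
  | zero =>
    rw [pow_zero, one_mul]
    exact Finset.single_le_sum (fun i _ => (hW.pos i).le) (by simp)
  | succ j ih =>
    set a : ℤ := k - (j + 1 : ℕ)
    set b : ℤ := k + (j + 1 : ℕ)
    have hab : a ≤ b := by lia
    have hsum : ∑ i ∈ Finset.Ico (a - 1) (b + 1), W i =
        W (a - 1) + ∑ i ∈ Finset.Ico a b, W i + W b := by
      rw [← Finset.insert_Ico_left_eq_Ico_sub_one (by lia),
        Finset.sum_insert (by simp), ← Finset.insert_Ico_right_eq_Ico_add_one hab,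
        Finset.sum_insert (by simp)]
      ring
    have hends : ε / B * ∑ i ∈ Finset.Ico a b, W i ≤ W (a - 1) + W b := by
      rw [div_mul_eq_mul_div, div_le_iff₀ hB]
      have := hW.succ_le (a - 1)
      rw [sub_add_cancel] at this
      nlinarith [h a b hab, hW.pos b, hW.one_le]
    rw [show k - (j + 1 + 1 : ℕ) = a - 1 by lia, show k + (j + 1 + 1 : ℕ) = b + 1 by lia, hsum,
      pow_succ']
    have : 0 < 1 + ε / B := by positivity
    nlinarith

theorem HasRatioBound.exists_doubling (hW : HasRatioBound B W) {ε : ℝ} (hε : 0 < ε)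
    (h : ∀ a b : ℤ, a ≤ b → ε * ∑ i ∈ Finset.Ico a b, W i ≤ W a + W b) :
    ∃ N : ℕ, 0 < N ∧ ∀ k, 2 * W k ≤ W (k + N) ∨ 2 * W k ≤ W (k - N) := by
  have hB : 0 < B := one_pos.trans_le hW.one_le
  obtain ⟨j, hj⟩ := pow_unbounded_of_one_lt (4 / ε) (show 1 < 1 + ε / B by simp [hε, hB])
  rw [div_lt_iff₀' hε] at hj
  refine ⟨j + 1, j.succ_pos, fun k => ?_⟩
  have hends : 4 * W k ≤ W (k - (j + 1 : ℕ)) + W (k + (j + 1 : ℕ)) := by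
    calc 4 * W k ≤ ε * (1 + ε / B) ^ j * W k := mul_le_mul_of_nonneg_right hj.le (hW.pos k).le
      _ = ε * ((1 + ε / B) ^ j * W k) := mul_assoc _ _ _
      _ ≤ _ := by gcongr; exact hW.mul_sum_symm_Ico_le hε.le h k j
      _ ≤ _ := h _ _ (by lia)
  by_contra! hlt
  linarith [hlt.1, hlt.2]

theorem GrowsAtRate.of_doubling (hW : HasRatioBound B W) {N : ℕ} (hN : 0 < N)
    (h : ∀ k, 2 * W k ≤ W (k + N) ∨ 2 * W k ≤ W (k - N)) :
    GrowsAtRate W {k | 2 * W k ≤ W (k + N)} (N : ℝ)⁻¹ := by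
  refine .of_step hW hN (fun k hk => (h (k + N)).resolve_right fun hback => ?_) fun k hk => ?_
  · rw [add_sub_cancel_right] at hback
    rw [mem_ofPred_eq] at hk
    linarith [hW.pos k]
  · rw [inv_mul_cancel₀ (by positivity), Real.rpow_one]
    exact hk

theorem isSplitAt_zero_of_doubling (hW : HasRatioBound B W) {N : ℕ} (hN : 0 < N)
    (h : ∀ k, 2 * W k ≤ W (k + N) ∨ 2 * W k ≤ W (k - N)) : IsSplitAt W 0 := by
  have hreflect : ∀ k, 2 * reflect W k ≤ reflect W (k + N) ∨
      2 * reflect W k ≤ reflect W (k - N) := fun k => by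
    simp only [reflect, neg_add', neg_sub', sub_neg_eq_add]
    exact (h (-k)).symm
  have hrate : (0 : ℝ) < (N : ℝ)⁻¹ := by positivity
  refine ⟨_, _, fun k => (h k).imp_right fun hk => ?_,
    ⟨_, hrate, .of_doubling hW hN h⟩, _, by rwa [neg_zero], .of_doubling hW.reflect hN hreflect⟩
  simpa [reflect, sub_eq_neg_add, add_comm] using hk

theorem IsSplitAt.of_tilt (h : IsSplitAt (tilt γ W) 0) : IsSplitAt W γ := by
  obtain ⟨K, L, hKL, ⟨δ₁, hδ₁, h₁⟩, δ₂, hδ₂, h₂⟩ := h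
  rw [reflect_tilt] at h₂
  exact ⟨K, L, hKL, ⟨γ + δ₁, by linarith, h₁.of_tilt⟩, -γ + δ₂, by linarith, h₂.of_tilt⟩

theorem exists_ends_le_mul_sum_Ico (hW : HasRatioBound B W) (hγ : ¬IsSplitAt W γ) {ε : ℝ}
    (hε : 0 < ε) : ∃ a b : ℤ, a ≤ b ∧
      tilt γ W a + tilt γ W b ≤ ε * ∑ i ∈ Finset.Ico a b, tilt γ W i := by
  by_contra! h
  obtain ⟨N, hN, hdouble⟩ := (hW.tilt γ).exists_doubling hε fun a b hab => (h a b hab).le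
  exact hγ (isSplitAt_zero_of_doubling (hW.tilt γ) hN hdouble).of_tilt

end split

section growthSeq

variable {B q : ℝ} {W : ℤ → ℝ} {K : Set ℤ}

theorem le_neg_mul_logb_iSup_iff (hW : HasRatioBound B W) (hq : 0 < q) (hK : K.Nonempty) {y : ℝ}
    (n : ℕ) : y ≤ -(q * Real.logb 2 (⨆ k : K, (W k / W (k + n)) ^ (1 / q))) ↔
      ∀ k ∈ K, 2 ^ y * W k ≤ W (k + n) := by
  have : Nonempty K := hK.to_subtype
  have hratio : ∀ k : ℤ, 0 < W k / W (k + n) := fun k => div_pos (hW.pos k) (hW.pos _)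
  have hbdd : BddAbove (range fun k : K => (W k / W (k + n)) ^ (1 / q)) := by
    refine ⟨(B ^ n) ^ (1 / q), ?_⟩
    rintro _ ⟨k, rfl⟩
    refine Real.rpow_le_rpow (hratio k).le ?_ (by positivity)
    exact (div_le_iff₀ (hW.pos _)).2 (hW.le_add_natCast k n)
  have hSup : 0 < ⨆ k : K, (W k / W (k + n)) ^ (1 / q) :=
    (Real.rpow_pos_of_pos (hratio _) _).trans_le (le_ciSup hbdd hK.to_subtype.some)
  have hpow : ((2 : ℝ) ^ (-y)) ^ (1 / q) = 2 ^ (-(y / q)) := by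
    rw [← Real.rpow_mul zero_le_two, mul_one_div, neg_div]
  rw [le_neg, ← le_div_iff₀' hq, neg_div, Real.logb_le_iff_le_rpow one_lt_two hSup,
    ciSup_le_iff hbdd, Subtype.forall]
  refine forall₂_congr fun k _ => ?_
  rw [← hpow, Real.rpow_le_rpow_iff (hratio k).le (by positivity) (by positivity),
    div_le_iff₀ (hW.pos _), Real.rpow_neg zero_le_two, ← div_eq_inv_mul,
    le_div_iff₀' (by positivity)]

theorem tendsto_div_natCast_of_affine_lower_bounds {s : ℕ → ℝ} {ρ : ℝ}
    (hupper : ∀ n : ℕ, 0 < n → s n ≤ ρ * n) (hlower : ∀ δ < ρ, ∃ c, ∀ n : ℕ, δ * n + c ≤ s n) :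
    Tendsto (fun n => s n / n) atTop (𝓝 ρ) := by
  refine tendsto_order.2 ⟨fun x hx => ?_, fun x hx => ?_⟩
  · obtain ⟨δ, hxδ, hδ⟩ := exists_between hx
    obtain ⟨c, hc⟩ := hlower δ hδ
    have hconst : Tendsto (fun n : ℕ => δ + c / n) atTop (𝓝 (δ + 0)) :=
      tendsto_const_nhds.add (tendsto_const_div_atTop_nhds_zero_nat c)
    rw [add_zero] at hconst
    filter_upwards [hconst.eventually_const_lt hxδ, eventually_gt_atTop 0] with n hx' hn
    have hn' : (0 : ℝ) < n := Nat.cast_pos.2 hn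
    rw [← mul_div_cancel_right₀ δ hn'.ne', ← add_div] at hx'
    exact hx'.trans_le (div_le_div_of_nonneg_right (hc n) hn'.le)
  · filter_upwards [eventually_gt_atTop 0] with n hn
    exact ((div_le_iff₀ (Nat.cast_pos.2 hn)).2 (hupper n hn)).trans_lt hx

theorem tendsto_growthRate_div (hW : HasRatioBound B W) (hq : 0 < q) (hK : K.Nonempty)
    (hsucc : ∀ k ∈ K, k + 1 ∈ K) :
    Tendsto (fun n : ℕ => -(1 / (n : ℝ) *
      Real.logb 2 (⨆ k : K, (W k / W (k + n)) ^ (1 / q)))) atTop (𝓝 (growthRate W K / q)) := by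
  have hadd : ∀ n : ℕ, ∀ k ∈ K, k + (n : ℤ) ∈ K := fun n => by
    induction n with
    | zero => simp
    | succ n ih => exact fun k hk => by simpa [add_assoc] using hsucc _ (ih k hk)
  have hlim : Tendsto (fun n : ℕ =>
      -(q * Real.logb 2 (⨆ k : K, (W k / W (k + n)) ^ (1 / q))) / n) atTop
      (𝓝 (growthRate W K)) := by
    refine tendsto_div_natCast_of_affine_lower_bounds (fun n hn => ?_) fun δ hδ => ?_
    · refine (div_le_iff₀ (Nat.cast_pos.2 hn)).1 ?_
      refine le_growthRate hW hK (.of_step hW hn (hadd n) ?_)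
      rw [div_mul_cancel₀ _ (by positivity)]
      exact (le_neg_mul_logb_iSup_iff hW hq hK n).1 le_rfl
    · obtain ⟨c, hc, hg⟩ := growsAtRate_of_lt_growthRate hW hδ
      refine ⟨Real.logb 2 c, fun n => (le_neg_mul_logb_iSup_iff hW hq hK n).2 fun k hk => ?_⟩
      rw [add_comm, Real.rpow_add two_pos, Real.rpow_logb two_pos one_lt_two.ne' hc]
      exact hg k hk n
  refine (hlim.div_const q).congr fun n => ?_
  field_simp

end growthSeq

/-! ### The Lorentz norm through the distribution function -/

theorem distribFun_anti (x : ℝ → ℝ) : Antitone (distribFun x) := fun _ _ h =>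
  measure_mono fun _ hs => ⟨hs.1, h.trans_lt hs.2⟩

theorem distribFun_eq_restrict (x : ℝ → ℝ) (τ : ℝ≥0∞) :
    distribFun x τ = volume.restrict (Ioi (0 : ℝ)) {s | τ < ENNReal.ofReal |x s|} := by
  rw [Measure.restrict_apply' measurableSet_Ioi, inter_comm]
  rfl

theorem distribFun_le_of_forall_gt {x : ℝ → ℝ} {τ b : ℝ≥0∞}
    (h : ∀ σ, τ < σ → distribFun x σ ≤ b) : distribFun x τ ≤ b := by
  rcases eq_or_ne τ ∞ with rfl | hτ
  · simp [distribFun]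
  obtain ⟨u, hu, hlt, hlim⟩ := exists_seq_strictAnti_tendsto' (lt_top_iff_ne_top.2 hτ)
  have hset : {s : ℝ | 0 < s ∧ τ < ENNReal.ofReal |x s|} =
      ⋃ n, {s : ℝ | 0 < s ∧ u n < ENNReal.ofReal |x s|} := by
    ext s
    simp only [mem_ofPred_eq, mem_iUnion]
    refine ⟨fun hs => ?_, fun ⟨n, hn⟩ => ⟨hn.1, (hlt n).1.trans hn.2⟩⟩
    obtain ⟨n, hn⟩ := (hlim.eventually (gt_mem_nhds hs.2)).exists
    exact ⟨n, hs.1, hn⟩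
  have hmono : Monotone fun n => {s : ℝ | 0 < s ∧ u n < ENNReal.ofReal |x s|} :=
    fun m n hmn s hs => ⟨hs.1, (hu.antitone hmn).trans_lt hs.2⟩
  rw [distribFun, hset, hmono.measure_iUnion]
  exact iSup_le fun n => h _ (hlt n).1

theorem rearrangement_anti (x : ℝ → ℝ) : Antitone (rearrangement x) := fun _ _ h =>
  sInf_le_sInf fun _ hτ => le_trans hτ (ENNReal.ofReal_le_ofReal h)

theorem lt_rearrangement_iff {x : ℝ → ℝ} {t : ℝ} {τ : ℝ≥0∞} :
    τ < rearrangement x t ↔ ENNReal.ofReal t < distribFun x τ := by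
  rw [← not_le, ← not_le, not_iff_not]
  refine ⟨fun h => distribFun_le_of_forall_gt fun σ hσ => ?_, fun h => sInf_le h⟩
  obtain ⟨ρ, hρ, hρσ⟩ := sInf_lt_iff.1 (h.trans_lt hσ)
  exact (distribFun_anti x hρσ.le).trans hρ

theorem Equimeasurable.distribFun_eq {x y : ℝ → ℝ} (h : Equimeasurable x y) {τ : ℝ≥0∞}
    (h0 : τ ≠ 0) (htop : τ ≠ ∞) : distribFun x τ = distribFun y τ := by
  have key : ∀ z : ℝ → ℝ, distribFun z τ = volume {s : ℝ | 0 < s ∧ τ.toReal < |z s|} := fun z => by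
    simp only [distribFun, ENNReal.lt_ofReal_iff_toReal_lt htop]
  rw [key, key, h _ (ENNReal.toReal_pos h0 htop)]

theorem DisjointSupports.const_mul {x y : ℝ → ℝ} (h : DisjointSupports x y) (a b : ℝ) :
    DisjointSupports (fun t => a * x t) fun t => b * y t := by
  filter_upwards [h] with t ht
  exact ht.imp (fun h => by rw [h, mul_zero]) fun h => by rw [h, mul_zero]

theorem lt_ofReal_abs_sum_iff {ι : Type*} [Fintype ι] {y : ι → ℝ}
    (hy : ∀ i j, i ≠ j → y i = 0 ∨ y j = 0) {τ : ℝ≥0∞} :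
    τ < ENNReal.ofReal |∑ i, y i| ↔ ∃ i, τ < ENNReal.ofReal |y i| := by
  by_cases hz : ∃ i, y i ≠ 0
  · obtain ⟨i, hi⟩ := hz
    have hother : ∀ j, j ≠ i → y j = 0 := fun j hj => (hy j i hj).resolve_right hi
    rw [Fintype.sum_eq_single i hother]
    refine ⟨fun h => ⟨i, h⟩, fun ⟨j, hj⟩ => ?_⟩
    by_cases hji : j = i
    · rwa [← hji]
    · simp [hother j hji] at hj
  · push Not at hz
    simp [hz]

theorem distribFun_sum {ι : Type*} [Fintype ι] {y : ι → ℝ → ℝ}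
    (hy : ∀ i, AEMeasurable (y i) (volume.restrict (Ioi (0 : ℝ))))
    (hd : ∀ i j, i ≠ j → DisjointSupports (y i) (y j)) (τ : ℝ≥0∞) :
    distribFun (fun t => ∑ i, y i t) τ = ∑ i, distribFun (y i) τ := by
  have hall : ∀ᵐ t ∂(volume.restrict (Ioi (0 : ℝ))), ∀ i j, i ≠ j → y i t = 0 ∨ y j t = 0 := by
    simp only [ae_all_iff]
    exact hd
  simp only [distribFun_eq_restrict]
  have hset : {s : ℝ | τ < ENNReal.ofReal |∑ i, y i s|} =ᵐ[volume.restrict (Ioi (0 : ℝ))]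
      ⋃ i, {s : ℝ | τ < ENNReal.ofReal |y i s|} := by
    filter_upwards [hall] with s hs
    refine propext ?_
    change τ < _ ↔ s ∈ ⋃ i, _
    simp only [mem_iUnion, mem_ofPred_eq]
    exact lt_ofReal_abs_sum_iff hs
  rw [measure_congr hset, measure_iUnion₀, tsum_fintype]
  · intro i j hij
    refine measure_mono_null ?_ (hd i j hij)
    rintro s ⟨hi, hj⟩ (h0 | h0)
    · simp [h0] at hi
    · simp [h0] at hj
  · exact fun i => nullMeasurableSet_lt aemeasurable_const
      (ENNReal.measurable_ofReal.comp_aemeasurable (hy i).norm)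

theorem volume_Ioi_lt_eq (y : ℝ≥0∞) :
    volume {s : ℝ | 0 < s ∧ ENNReal.ofReal s < y} = y := by
  rcases eq_or_ne y ∞ with rfl | hy
  · have : {s : ℝ | 0 < s ∧ ENNReal.ofReal s < ∞} = Ioi 0 := by ext; simp
    rw [this, Real.volume_Ioi]
  · have : {s : ℝ | 0 < s ∧ ENNReal.ofReal s < y} = Ioo 0 y.toReal := by
      ext s
      simp only [mem_ofPred_eq, mem_Ioo, and_congr_right_iff]
      exact fun hs => ENNReal.ofReal_lt_iff_lt_toReal hs.le hy
    rw [this, Real.volume_Ioo, sub_zero, ENNReal.ofReal_toReal hy]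

theorem lintegral_eq_lintegral_measure_lt {α : Type*} [MeasurableSpace α] {μ : Measure α}
    [SFinite μ] {f : α → ℝ≥0∞} (hf : Measurable f) :
    ∫⁻ t, f t ∂μ = ∫⁻ s in Ioi (0 : ℝ), μ {t | ENNReal.ofReal s < f t} := by
  have hS : MeasurableSet {p : α × ℝ | ENNReal.ofReal p.2 < f p.1} :=
    measurableSet_lt (ENNReal.measurable_ofReal.comp measurable_snd) (hf.comp measurable_fst)
  have hlayer : ∀ t, f t = ∫⁻ s in Ioi (0 : ℝ),
      {p : α × ℝ | ENNReal.ofReal p.2 < f p.1}.indicator 1 (t, s) := fun t => by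
    have hm : MeasurableSet {s : ℝ | ENNReal.ofReal s < f t} := measurable_prodMk_left hS
    have : (fun s : ℝ => {p : α × ℝ | ENNReal.ofReal p.2 < f p.1}.indicator (1 : α × ℝ → ℝ≥0∞)
        (t, s)) = {s : ℝ | ENNReal.ofReal s < f t}.indicator 1 := rfl
    rw [this, lintegral_indicator_one hm, Measure.restrict_apply hm, inter_comm]
    exact (volume_Ioi_lt_eq (f t)).symm
  rw [lintegral_congr hlayer, lintegral_lintegral_swap]
  · refine lintegral_congr fun s => ?_
    have hm : MeasurableSet {t : α | ENNReal.ofReal s < f t} := measurable_prodMk_right hS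
    exact lintegral_indicator_one hm
  · exact (measurable_one.indicator hS).aemeasurable

/-- The extension `D ↦ dψ [0, D)` of `ψ` to `[0, ∞]`. -/
noncomputable def psiExt (ψ : ℝ → ℝ) (hψ : MonotoneOn ψ (Ici 0)) (D : ℝ≥0∞) : ℝ≥0∞ :=
  dPsi ψ hψ {t | 0 ≤ t ∧ ENNReal.ofReal t < D}

/-- The `q`-th power of the Lorentz norm of a function with distribution function `H`. -/
noncomputable def lorentzEnergy (q : ℝ) (ψ : ℝ → ℝ) (hψ : MonotoneOn ψ (Ici 0))
    (H : ℝ≥0∞ → ℝ≥0∞) : ℝ≥0∞ :=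
  ∫⁻ s in Ioi (0 : ℝ), psiExt ψ hψ (H (ENNReal.ofReal s ^ (1 / q)))

section psiExt

variable {ψ : ℝ → ℝ} (hψ : MonotoneOn ψ (Ici 0))

theorem psiExt_mono : Monotone (psiExt ψ hψ) :=
  fun _ _ h => measure_mono fun _ ht => ⟨ht.1, ht.2.trans_le h⟩

theorem psiExt_zero : psiExt ψ hψ 0 = 0 := by
  simp [psiExt]

theorem psiExt_top_le {b : ℝ≥0∞}
    (h : ∀ t : ℝ, 0 < t → psiExt ψ hψ (ENNReal.ofReal t) ≤ b) : psiExt ψ hψ ∞ ≤ b := by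
  have hset : {t : ℝ | 0 ≤ t ∧ ENNReal.ofReal t < ∞} =
      ⋃ n : ℕ, {t : ℝ | 0 ≤ t ∧ ENNReal.ofReal t < ENNReal.ofReal (n + 1)} := by
    ext t
    simp only [mem_ofPred_eq, ENNReal.ofReal_lt_top, and_true, mem_iUnion]
    refine ⟨fun ht => ?_, fun ⟨n, hn⟩ => hn.1⟩
    obtain ⟨n, hn⟩ := exists_nat_gt t
    exact ⟨n, ht, (ENNReal.ofReal_lt_ofReal_iff (by positivity)).2 (by linarith)⟩
  have hmono : Monotone fun n : ℕ =>
      {t : ℝ | 0 ≤ t ∧ ENNReal.ofReal t < ENNReal.ofReal (n + 1)} := fun m n hmn t ht =>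
    ⟨ht.1, ht.2.trans_le (ENNReal.ofReal_le_ofReal (by gcongr))⟩
  rw [psiExt, hset, hmono.measure_iUnion]
  exact iSup_le fun n => h _ (by positivity)

theorem dPsi_Ico {t : ℝ} (ht : 0 < t) (hcont : ContinuousAt ψ t) :
    dPsi ψ hψ (Ico 0 t) = ENNReal.ofReal (ψ t - ψ 0) := by
  have hmono := monotone_extend_of_monotoneOn hψ
  have hleft : ∀ a, Function.leftLim hmono.stieltjesFunction a =
      Function.leftLim (fun t : ℝ => ψ (max t 0)) a := fun a => by
    have : (hmono.stieltjesFunction : ℝ → ℝ) = Function.rightLim fun t : ℝ => ψ (max t 0) :=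
      funext fun x => hmono.stieltjesFunction_eq x
    rw [this, leftLim_rightLim]
    exact hmono.tendsto_leftLim a
  have hleft_zero : Function.leftLim (fun t : ℝ => ψ (max t 0)) 0 = ψ 0 := by
    refine leftLim_eq_of_tendsto (tendsto_const_nhds.congr' ?_)
    filter_upwards [self_mem_nhdsWithin] with s hs
    rw [max_eq_right (le_of_lt hs)]
  have hleft_t : Function.leftLim (fun t : ℝ => ψ (max t 0)) t = ψ t := by
    have hc : ContinuousAt (fun t : ℝ => ψ (max t 0)) t := by
      refine ContinuousAt.comp (f := fun t : ℝ => max t 0) (g := ψ) ?_ (by fun_prop)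
      rwa [max_eq_left ht.le]
    rw [hc.continuousWithinAt.leftLim_eq, max_eq_left ht.le]
  rw [dPsi, StieltjesFunction.measure_Ico, hleft, hleft, hleft_zero, hleft_t]

theorem psiExt_ofReal (hconc : ConcaveOn ℝ (Ici 0) ψ) (hzero : ψ 0 = 0) {t : ℝ} (ht : 0 ≤ t) :
    psiExt ψ hψ (ENNReal.ofReal t) = ENNReal.ofReal (ψ t) := by
  rcases ht.eq_or_lt with rfl | ht
  · simp [psiExt_zero, hzero]
  have hset : {s : ℝ | 0 ≤ s ∧ ENNReal.ofReal s < ENNReal.ofReal t} = Ico 0 t := by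
    ext s
    simp only [mem_ofPred_eq, mem_Ico, and_congr_right_iff]
    exact fun _ => ENNReal.ofReal_lt_ofReal_iff ht
  have hcont : ContinuousAt ψ t := by
    have := hconc.continuousOn_interior
    rw [interior_Ici] at this
    exact this.continuousAt (Ioi_mem_nhds ht)
  rw [psiExt, hset, dPsi_Ico hψ ht hcont, hzero, sub_zero]

end psiExt

section lorentzEnergy

variable {q : ℝ} {ψ : ℝ → ℝ} (hψ : MonotoneOn ψ (Ici 0))

theorem lorentzNorm_rpow (hq : 0 < q) (x : ℝ → ℝ) :
    lorentzNorm q ψ hψ x ^ q = lorentzEnergy q ψ hψ (distribFun x) := by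
  have : SFinite (dPsi ψ hψ) := by unfold dPsi; infer_instance
  rw [lorentzNorm, one_div, ENNReal.rpow_inv_rpow hq.ne',
    lintegral_eq_lintegral_measure_lt ((rearrangement_anti x).measurable.pow_const q)]
  refine lintegral_congr fun s => ?_
  rw [Measure.restrict_apply' measurableSet_Ici, psiExt, inter_comm]
  congr 1
  ext t
  simp only [mem_inter_iff, mem_Ici, mem_ofPred_eq, and_congr_right_iff]
  rw [← lt_rearrangement_iff, one_div, ENNReal.rpow_inv_lt_iff hq]
  exact fun _ => Iff.rfl

theorem measurable_psiExt_comp (hq : 0 < q) {H : ℝ≥0∞ → ℝ≥0∞} (hH : Antitone H) :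
    Measurable fun s : ℝ => psiExt ψ hψ (H (ENNReal.ofReal s ^ (1 / q))) :=
  Antitone.measurable fun s t hst => psiExt_mono hψ (hH (by gcongr))

theorem lorentzEnergy_congr (hq : 0 < q) {H G : ℝ≥0∞ → ℝ≥0∞}
    (h : ∀ τ, τ ≠ 0 → τ ≠ ∞ → H τ = G τ) : lorentzEnergy q ψ hψ H = lorentzEnergy q ψ hψ G := by
  refine setLIntegral_congr_fun measurableSet_Ioi fun s hs => ?_
  have hs' : ENNReal.ofReal s ≠ 0 := (ENNReal.ofReal_pos.2 hs).ne'
  rw [h _ (by simp [hs', hq.not_gt, ENNReal.rpow_eq_zero_iff])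
    (by simp [hq.not_gt, hs', ENNReal.rpow_eq_top_iff])]

end lorentzEnergy

/-! ### Lorentz weights at the powers of two -/

/-- The weights of Lorentz spaces: nondecreasing concave functions on `[0, ∞)` that vanish exactly
at `0`. -/
structure IsLorentzWeight (ψ : ℝ → ℝ) : Prop where
  monotoneOn : MonotoneOn ψ (Ici 0)
  concaveOn : ConcaveOn ℝ (Ici 0) ψ
  map_zero : ψ 0 = 0
  pos : ∀ t, 0 < t → 0 < ψ t

/-- The two-sided sequence `k ↦ ψ (2 ^ k)`, whose growth rates are the dilation indices of `ψ`. -/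
noncomputable def dyadicValues (ψ : ℝ → ℝ) (k : ℤ) : ℝ := ψ (2 ^ k)

theorem le_mul_of_concaveOn_of_zero {ψ : ℝ → ℝ} (hconc : ConcaveOn ℝ (Ici 0) ψ) (hzero : ψ 0 = 0)
    {c t : ℝ} (hc : 1 ≤ c) (ht : 0 ≤ t) : ψ (c * t) ≤ c * ψ t := by
  have hc0 : 0 < c := by linarith
  have h := hconc.2 (mem_Ici.2 (mul_nonneg hc0.le ht)) (mem_Ici.2 le_rfl) (inv_nonneg.2 hc0.le)
    (sub_nonneg.2 (inv_le_one_of_one_le₀ hc)) (by ring)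
  simp only [smul_eq_mul, mul_zero, add_zero, hzero] at h
  rwa [inv_mul_cancel_left₀ hc0.ne', inv_mul_le_iff₀ hc0] at h

theorem two_pow_mul_ofReal (n : ℕ) (t : ℝ) :
    (2 : ℝ≥0∞) ^ n * ENNReal.ofReal t = ENNReal.ofReal (2 ^ n * t) := by
  rw [ENNReal.ofReal_mul (by positivity), ENNReal.ofReal_pow zero_le_two, ENNReal.ofReal_ofNat]

namespace IsLorentzWeight

variable {ψ : ℝ → ℝ}

theorem le_of_le (hψ : IsLorentzWeight ψ) {s t : ℝ} (hs : 0 ≤ s) (hst : s ≤ t) : ψ s ≤ ψ t :=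
  hψ.monotoneOn (mem_Ici.2 hs) (mem_Ici.2 (hs.trans hst)) hst

theorem nonneg (hψ : IsLorentzWeight ψ) {t : ℝ} (ht : 0 ≤ t) : 0 ≤ ψ t :=
  hψ.map_zero.ge.trans (hψ.le_of_le le_rfl ht)

theorem psiExt_ofReal (hψ : IsLorentzWeight ψ) {t : ℝ} (ht : 0 ≤ t) :
    psiExt ψ hψ.monotoneOn (ENNReal.ofReal t) = ENNReal.ofReal (ψ t) :=
  _root_.psiExt_ofReal hψ.monotoneOn hψ.concaveOn hψ.map_zero ht

theorem monotone_dyadicValues (hψ : IsLorentzWeight ψ) : Monotone (dyadicValues ψ) := fun _ _ h =>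
  hψ.le_of_le (by positivity) (zpow_le_zpow_right₀ one_le_two h)

theorem hasRatioBound (hψ : IsLorentzWeight ψ) : HasRatioBound 2 (dyadicValues ψ) where
  pos k := hψ.pos _ (by positivity)
  succ_le k := by
    rw [dyadicValues, zpow_add_one₀ two_ne_zero, mul_comm]
    exact le_mul_of_concaveOn_of_zero hψ.concaveOn hψ.map_zero one_le_two (by positivity)
  le_succ k := by
    have hpos : 0 < dyadicValues ψ (k + 1) := hψ.pos _ (by positivity)
    linarith [hψ.monotone_dyadicValues (show k ≤ k + 1 by lia)]

theorem exists_dyadicValues_le (hψ : IsLorentzWeight ψ) {t : ℝ} (ht : 0 < t) : ∃ k : ℤ, ∀ n : ℕ,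
    dyadicValues ψ (k + n) ≤ ψ (2 ^ n * t) ∧ ψ (2 ^ n * t) ≤ 2 * dyadicValues ψ (k + n) := by
  obtain ⟨k, hk₁, hk₂⟩ := exists_mem_Ico_zpow ht one_lt_two
  refine ⟨k, fun n => ⟨hψ.le_of_le (by positivity) ?_, ?_⟩⟩
  · rw [zpow_add₀ two_ne_zero, mul_comm, zpow_natCast]
    gcongr
  · refine (hψ.le_of_le (by positivity) ?_).trans (hψ.hasRatioBound.succ_le (k + n))
    rw [add_right_comm, zpow_add₀ two_ne_zero, mul_comm, zpow_natCast]
    gcongr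

theorem psiExt_two_pow_mul_le (hψ : IsLorentzWeight ψ) {m l : ℕ} {C₁ C₂ : ℝ}
    (hC₁ : 0 ≤ C₁) (hC₂ : 0 ≤ C₂)
    (h : ∀ k, dyadicValues ψ (k + m) ≤ C₁ * dyadicValues ψ k + C₂ * dyadicValues ψ (k + l))
    (D : ℝ≥0∞) : psiExt ψ hψ.monotoneOn (2 ^ m * D) ≤
      ENNReal.ofReal (2 * C₁) * psiExt ψ hψ.monotoneOn D +
        ENNReal.ofReal (2 * C₂) * psiExt ψ hψ.monotoneOn (2 ^ l * D) := by
  have hreal : ∀ t : ℝ, 0 < t → psiExt ψ hψ.monotoneOn (2 ^ m * ENNReal.ofReal t) ≤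
      ENNReal.ofReal (2 * C₁) * psiExt ψ hψ.monotoneOn (ENNReal.ofReal t) +
        ENNReal.ofReal (2 * C₂) * psiExt ψ hψ.monotoneOn (2 ^ l * ENNReal.ofReal t) := by
    intro t ht
    obtain ⟨k, hk⟩ := hψ.exists_dyadicValues_le ht
    have hk₀ : dyadicValues ψ k ≤ ψ t := by simpa using (hk 0).1
    rw [two_pow_mul_ofReal, two_pow_mul_ofReal, hψ.psiExt_ofReal (by positivity),
      hψ.psiExt_ofReal ht.le, hψ.psiExt_ofReal (by positivity),
      ← ENNReal.ofReal_mul (by positivity), ← ENNReal.ofReal_mul (by positivity)]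
    refine (ENNReal.ofReal_le_ofReal ?_).trans ENNReal.ofReal_add_le
    calc ψ (2 ^ m * t) ≤ 2 * dyadicValues ψ (k + m) := (hk m).2
      _ ≤ 2 * (C₁ * dyadicValues ψ k + C₂ * dyadicValues ψ (k + l)) := by gcongr; exact h k
      _ ≤ 2 * (C₁ * ψ t + C₂ * ψ (2 ^ l * t)) := by gcongr; exact (hk l).1
      _ = _ := by ring
  rcases eq_or_ne D 0 with rfl | hD0
  · simp [psiExt_zero]
  rcases eq_or_ne D ∞ with rfl | hD
  · rw [ENNReal.mul_top (by positivity), ENNReal.mul_top (by positivity)]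
    refine psiExt_top_le _ fun t ht => ?_
    have ht' : ENNReal.ofReal t ≤ 2 ^ m * ENNReal.ofReal t :=
      le_mul_of_one_le_left zero_le (one_le_pow₀ one_le_two)
    refine ((psiExt_mono _ ht').trans (hreal t ht)).trans ?_
    gcongr <;> exact psiExt_mono _ le_top
  · simpa only [ENNReal.ofReal_toReal hD] using hreal D.toReal (ENNReal.toReal_pos hD0 hD)

end IsLorentzWeight

/-! ### Necessity -/

theorem sum_fin_ite_lt {M : Type*} [AddCommMonoid M] {m n : ℕ} (h : m ≤ n) (c : M) :
    (∑ k : Fin n, if (k : ℕ) < m then c else 0) = m • c := by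
  rw [Fin.sum_univ_eq_sum_range (fun k => if k < m then c else 0) n, ← Finset.sum_filter]
  have : (Finset.range n).filter (· < m) = Finset.range m := by
    ext k
    simp only [Finset.mem_filter, Finset.mem_range]
    lia
  rw [this, Finset.sum_const, Finset.card_range]

theorem norm_toLp_ite_lt {p : ℝ≥0∞} (hp : 1 ≤ p) {m n : ℕ} (hm : 0 < m) (h : m ≤ n) :
    ‖(WithLp.toLp p (fun k : Fin n => if (k : ℕ) < m then (1 : ℝ) else 0) :
      PiLp p fun _ : Fin n => ℝ)‖ = (m : ℝ) ^ (p⁻¹).toReal := by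
  rcases eq_or_ne p ∞ with rfl | hp'
  · have : Nonempty (Fin n) := ⟨⟨0, by lia⟩⟩
    rw [PiLp.norm_eq_ciSup]
    simp only [ENNReal.inv_top, ENNReal.toReal_zero, Real.rpow_zero]
    refine le_antisymm (ciSup_le fun k => ?_) ?_
    · split_ifs <;> simp
    · refine le_ciSup_of_le (finite_range _).bddAbove ⟨0, by lia⟩ ?_
      simp [hm]
  · have hp0 : 0 < p.toReal := ENNReal.toReal_pos (by positivity) hp'
    rw [PiLp.norm_eq_sum hp0, ENNReal.toReal_inv, one_div]
    congr 1
    have : ∀ k : Fin n, ‖(if (k : ℕ) < m then (1 : ℝ) else 0)‖ ^ p.toReal =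
        if (k : ℕ) < m then 1 else 0 := fun k => by
      split_ifs
      · simp
      · simp [hp0.ne']
    simp only [this]
    rw [sum_fin_ite_lt h, nsmul_eq_mul, mul_one]

theorem distribFun_sum_ite_lt {n : ℕ} {x : Fin n → ℝ → ℝ}
    (hx : ∀ k, AEMeasurable (x k) (volume.restrict (Ioi (0 : ℝ))))
    (heq : ∀ i j, Equimeasurable (x i) (x j))
    (hdisj : ∀ i j, i ≠ j → DisjointSupports (x i) (x j)) {m : ℕ} (hm : m ≤ n) (i : Fin n)
    {τ : ℝ≥0∞} (h0 : τ ≠ 0) (htop : τ ≠ ∞) :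
    distribFun (fun t => ∑ k : Fin n, (if (k : ℕ) < m then (1 : ℝ) else 0) * x k t) τ =
      m * distribFun (x i) τ := by
  rw [distribFun_sum (fun k => (hx k).const_mul _) fun j k hjk => (hdisj j k hjk).const_mul _ _,
    ← nsmul_eq_mul, ← sum_fin_ite_lt hm]
  refine Finset.sum_congr rfl fun k _ => ?_
  split_ifs
  · simpa only [one_mul] using (heq k i).distribFun_eq h0 htop
  · simp [distribFun]

theorem SymmFinitelyRepresented.exists_lorentzEnergy_bounds {q : ℝ} (hq : 0 < q) {ψ : ℝ → ℝ}
    {hψ : MonotoneOn ψ (Ici 0)} {p : ℝ≥0∞} (hp : 1 ≤ p)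
    (hrep : SymmFinitelyRepresented (lorentzNorm q ψ hψ) p) (N : ℕ) :
    ∃ x, ∀ n, 0 < n → n ≤ N →
      ENNReal.ofReal ((2⁻¹ * (n : ℝ) ^ (p⁻¹).toReal) ^ q) ≤
          lorentzEnergy q ψ hψ (fun τ => n * distribFun x τ) ∧
        lorentzEnergy q ψ hψ (fun τ => n * distribFun x τ) ≤
          ENNReal.ofReal ((2 * (n : ℝ) ^ (p⁻¹).toReal) ^ q) := by
  rcases N.eq_zero_or_pos with rfl | hN
  · exact ⟨0, fun n hn hn' => absurd hn (by lia)⟩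
  obtain ⟨x, hx, heq, hdisj, hnorm⟩ := hrep N 1 one_pos
  refine ⟨x ⟨0, hN⟩, fun n hn hnN => ?_⟩
  have hnorm := hnorm fun k => if (k : ℕ) < n then (1 : ℝ) else 0
  rw [norm_toLp_ite_lt hp hn hnN, one_add_one_eq_two] at hnorm
  rw [← lorentzEnergy_congr hψ hq fun τ =>
      distribFun_sum_ite_lt (fun k => (hx k).1) heq hdisj hnN ⟨0, hN⟩,
    ← lorentzNorm_rpow hψ hq, ← ENNReal.ofReal_rpow_of_nonneg (by positivity) hq.le,
    ← ENNReal.ofReal_rpow_of_nonneg (by positivity) hq.le]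
  exact ⟨ENNReal.rpow_le_rpow hnorm.1 hq.le, ENNReal.rpow_le_rpow hnorm.2 hq.le⟩

theorem SymmFinitelyRepresented.exists_lorentzEnergy_two_pow_bounds {q : ℝ} (hq : 0 < q)
    {ψ : ℝ → ℝ} {hψ : MonotoneOn ψ (Ici 0)} {p : ℝ≥0∞} (hp : 1 ≤ p)
    (hrep : SymmFinitelyRepresented (lorentzNorm q ψ hψ) p) (J : ℕ) :
    ∃ x, ∀ j ≤ J,
      ENNReal.ofReal (2⁻¹ ^ q * 2 ^ (q * (p⁻¹).toReal * j)) ≤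
          lorentzEnergy q ψ hψ (fun τ => 2 ^ j * distribFun x τ) ∧
        lorentzEnergy q ψ hψ (fun τ => 2 ^ j * distribFun x τ) ≤
          ENNReal.ofReal (2 ^ q * 2 ^ (q * (p⁻¹).toReal * j)) := by
  obtain ⟨x, hx⟩ := hrep.exists_lorentzEnergy_bounds hq hp (2 ^ J)
  refine ⟨x, fun j hj => ?_⟩
  have hpow : ∀ c : ℝ, 0 ≤ c →
      (c * ((2 ^ j : ℕ) : ℝ) ^ (p⁻¹).toReal) ^ q = c ^ q * 2 ^ (q * (p⁻¹).toReal * j) := by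
    intro c hc
    rw [Real.mul_rpow hc (by positivity), Nat.cast_pow, Nat.cast_ofNat, ← Real.rpow_natCast,
      ← Real.rpow_mul zero_le_two, ← Real.rpow_mul zero_le_two]
    ring_nf
  have h := hx (2 ^ j) (by positivity) (Nat.pow_le_pow_right two_pos hj)
  rw [hpow _ (by norm_num), hpow _ zero_le_two] at h
  simpa only [Nat.cast_pow, Nat.cast_ofNat] using h

theorem eventually_le_mul_two_rpow {δ : ℝ} (hδ : 0 < δ) {c : ℝ} (hc : 0 < c) (C : ℝ) :
    ∀ᶠ m : ℕ in atTop, C ≤ c * 2 ^ (δ * m) := by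
  have h := (tendsto_pow_atTop_atTop_of_one_lt
    (Real.one_lt_rpow one_lt_two hδ)).const_mul_atTop hc
  filter_upwards [h.eventually_ge_atTop C] with m hm
  rwa [Real.rpow_mul_natCast zero_le_two]

theorem IsSplitAt.exists_middle_le {W : ℤ → ℝ} (hW : ∀ k, 0 < W k) {γ : ℝ} (h : IsSplitAt W γ)
    {ε : ℝ} (hε : 0 < ε) : ∃ m : ℕ, ∀ k,
      W (k + m) ≤ ε * 2 ^ (γ * m) * W k + ε * 2 ^ (-(γ * m)) * W (k + (2 * m : ℕ)) := by
  obtain ⟨K, L, hKL, ⟨δ₁, hδ₁, c₁, hc₁, hright⟩, δ₂, hδ₂, c₂, hc₂, hleft⟩ := h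
  obtain ⟨m, hm₁, hm₂⟩ := ((eventually_le_mul_two_rpow (sub_pos.2 hδ₁) (mul_pos hε hc₁) 1).and
    (eventually_le_mul_two_rpow (sub_pos.2 hδ₂) (mul_pos hε hc₂) 1)).exists
  refine ⟨m, fun k => ?_⟩
  have hWk := hW k
  have hWm := hW (k + m)
  have hW2m := hW (k + (2 * m : ℕ))
  rcases hKL (k + m) with hk | hk
  · have hgrow := hright _ hk m
    rw [show k + m + m = k + (2 * m : ℕ) by push_cast; ring] at hgrow
    calc W (k + m) ≤ ε * c₁ * 2 ^ ((δ₁ - γ) * m) * W (k + m) := le_mul_of_one_le_left hWm.le hm₁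
      _ = ε * 2 ^ (-(γ * m)) * (c₁ * 2 ^ (δ₁ * m) * W (k + m)) := by
        rw [sub_mul, sub_eq_add_neg, Real.rpow_add two_pos]
        ring
      _ ≤ ε * 2 ^ (-(γ * m)) * W (k + (2 * m : ℕ)) := by gcongr
      _ ≤ _ := le_add_of_nonneg_left (by positivity)
  · have hgrow := hleft _ hk m
    rw [reflect, reflect, neg_neg, show -(-(k + m) + m : ℤ) = k by ring] at hgrow
    calc W (k + m) ≤ ε * c₂ * 2 ^ ((δ₂ - -γ) * m) * W (k + m) := le_mul_of_one_le_left hWm.le hm₂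
      _ = ε * 2 ^ (γ * m) * (c₂ * 2 ^ (δ₂ * m) * W (k + m)) := by
        rw [sub_neg_eq_add, add_mul, Real.rpow_add two_pos]
        ring
      _ ≤ ε * 2 ^ (γ * m) * W k := by gcongr
      _ ≤ _ := le_add_of_nonneg_right (by positivity)

theorem IsLorentzWeight.lorentzEnergy_two_pow_mul_le {q : ℝ} (hq : 0 < q) {ψ : ℝ → ℝ}
    (hψ : IsLorentzWeight ψ) {m l : ℕ} {C₁ C₂ : ℝ} (hC₁ : 0 ≤ C₁) (hC₂ : 0 ≤ C₂)
    (h : ∀ k, dyadicValues ψ (k + m) ≤ C₁ * dyadicValues ψ k + C₂ * dyadicValues ψ (k + l))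
    {H : ℝ≥0∞ → ℝ≥0∞} (hH : Antitone H) :
    lorentzEnergy q ψ hψ.monotoneOn (fun τ => 2 ^ m * H τ) ≤
      ENNReal.ofReal (2 * C₁) * lorentzEnergy q ψ hψ.monotoneOn H +
        ENNReal.ofReal (2 * C₂) * lorentzEnergy q ψ hψ.monotoneOn (fun τ => 2 ^ l * H τ) := by
  have hmeas := measurable_psiExt_comp hψ.monotoneOn hq hH
  have hmeas' := measurable_psiExt_comp hψ.monotoneOn hq (hH.const_mul' (2 ^ l))
  rw [lorentzEnergy, lorentzEnergy, lorentzEnergy, ← lintegral_const_mul _ hmeas,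
    ← lintegral_const_mul _ hmeas', ← lintegral_add_left (hmeas.const_mul _)]
  exact lintegral_mono fun s => hψ.psiExt_two_pow_mul_le hC₁ hC₂ h _

theorem IsLorentzWeight.not_isSplitAt_of_symmFinitelyRepresented {q : ℝ} (hq : 0 < q) {ψ : ℝ → ℝ}
    (hψ : IsLorentzWeight ψ) {p : ℝ≥0∞} (hp : 1 ≤ p)
    (hrep : SymmFinitelyRepresented (lorentzNorm q ψ hψ.monotoneOn) p) :
    ¬ IsSplitAt (dyadicValues ψ) (q * (p⁻¹).toReal) := by
  intro hsplit
  set γ := q * (p⁻¹).toReal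
  have hε : (0 : ℝ) < (2⁻¹ ^ q / (8 * 2 ^ q)) := by positivity
  obtain ⟨m, hm⟩ := hsplit.exists_middle_le hψ.hasRatioBound.pos hε
  obtain ⟨x, hbounds⟩ := hrep.exists_lorentzEnergy_two_pow_bounds hq hp (2 * m)
  have hmiddle := hψ.lorentzEnergy_two_pow_mul_le hq (by positivity) (by positivity) hm
    (distribFun_anti x)
  have hlow := (hbounds m (by lia)).1
  have hupp := (hbounds (2 * m) le_rfl).2
  have hupp₀ := (hbounds 0 (by lia)).2
  simp only [pow_zero, one_mul, Nat.cast_zero, mul_zero, Real.rpow_zero, mul_one] at hupp₀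
  have h := hlow.trans (hmiddle.trans (add_le_add (mul_le_mul_right hupp₀ _)
    (mul_le_mul_right hupp _)))
  rw [← ENNReal.ofReal_mul (by positivity), ← ENNReal.ofReal_mul (by positivity),
    ← ENNReal.ofReal_add (by positivity) (by positivity),
    ENNReal.ofReal_le_ofReal_iff (by positivity)] at h
  have hdouble : (2 : ℝ) ^ (-(γ * m)) * 2 ^ (γ * (2 * m : ℕ)) = 2 ^ (γ * m) := by
    rw [← Real.rpow_add two_pos]
    push_cast
    ring_nf
  have hhalf : 2⁻¹ ^ q * (2 : ℝ) ^ (γ * m) ≤ 2⁻¹ ^ q * (2 : ℝ) ^ (γ * m) / 2 := by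
    refine h.trans (le_of_eq ?_)
    calc _ = 2⁻¹ ^ q / 4 * ((2 : ℝ) ^ (γ * m) +
          (2 : ℝ) ^ (-(γ * m)) * 2 ^ (γ * (2 * m : ℕ))) := by field_simp; ring
      _ = _ := by rw [hdouble]; ring
  have hpos : 0 < 2⁻¹ ^ q * (2 : ℝ) ^ (γ * m) := by positivity
  linarith

/-! ### Sufficiency: sums of disjoint translates -/

theorem distribFun_const_mul {c : ℝ} (hc : c ≠ 0) (x : ℝ → ℝ) (τ : ℝ≥0∞) :
    distribFun (fun t => c * x t) τ = distribFun x (τ / ENNReal.ofReal |c|) := by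
  have hc' : ENNReal.ofReal |c| ≠ 0 := (ENNReal.ofReal_pos.2 (abs_pos.2 hc)).ne'
  simp only [distribFun, abs_mul, ENNReal.ofReal_mul (abs_nonneg c)]
  congr 1
  ext s
  simp only [mem_ofPred_eq, and_congr_right_iff]
  intro _
  rw [ENNReal.div_lt_iff (Or.inl hc') (Or.inl ENNReal.ofReal_ne_top), mul_comm]

theorem rearrangement_const_mul (c : ℝ) (x : ℝ → ℝ) (t : ℝ) :
    rearrangement (fun t => c * x t) t = ENNReal.ofReal |c| * rearrangement x t := by
  rcases eq_or_ne c 0 with rfl | hc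
  · simp [rearrangement, distribFun]
  have hc' : ENNReal.ofReal |c| ≠ 0 := (ENNReal.ofReal_pos.2 (abs_pos.2 hc)).ne'
  refine eq_of_forall_lt_iff fun τ => ?_
  rw [lt_rearrangement_iff, distribFun_const_mul hc, ← lt_rearrangement_iff,
    ENNReal.div_lt_iff (Or.inl hc') (Or.inl ENNReal.ofReal_ne_top), mul_comm]

theorem lorentzNorm_const_mul {q : ℝ} (hq : 0 < q) {ψ : ℝ → ℝ} (hψ : MonotoneOn ψ (Ici 0))
    (c : ℝ) (x : ℝ → ℝ) :
    lorentzNorm q ψ hψ (fun t => c * x t) = ENNReal.ofReal |c| * lorentzNorm q ψ hψ x := by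
  simp only [lorentzNorm, rearrangement_const_mul, ENNReal.mul_rpow_of_nonneg _ _ hq.le]
  rw [lintegral_const_mul _ ((rearrangement_anti x).measurable.pow_const q),
    ENNReal.mul_rpow_of_nonneg _ _ (by positivity), one_div, ENNReal.rpow_rpow_inv hq.ne']

theorem equimeasurable_of_distribFun_eq {x y : ℝ → ℝ} (h : distribFun x = distribFun y) :
    Equimeasurable x y := fun τ hτ => by
  have := congrFun h (ENNReal.ofReal τ)
  simpa only [distribFun, ENNReal.ofReal_lt_ofReal_iff_of_nonneg hτ.le] using this

theorem bounds_of_homogeneous {E : Type*} [NormedAddCommGroup E] [NormedSpace ℝ E] {N : E → ℝ≥0∞}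
    (hN : ∀ (r : ℝ) v, N (r • v) = ENNReal.ofReal |r| * N v) {b B : ℝ}
    (h : ∀ v, ‖v‖ = 1 → ENNReal.ofReal b ≤ N v ∧ N v ≤ ENNReal.ofReal B) (v : E) :
    ENNReal.ofReal (b * ‖v‖) ≤ N v ∧ N v ≤ ENNReal.ofReal (B * ‖v‖) := by
  rcases eq_or_ne v 0 with rfl | hv
  · have hzero : N 0 = 0 := by simpa using hN 0 0
    simp [hzero]
  have hunit : ‖‖v‖⁻¹ • v‖ = 1 := by
    rw [norm_smul, norm_inv, norm_norm, inv_mul_cancel₀ (norm_ne_zero_iff.2 hv)]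
  have hscale : N v = ENNReal.ofReal ‖v‖ * N (‖v‖⁻¹ • v) := by
    rw [← abs_of_nonneg (norm_nonneg v), ← hN, abs_of_nonneg (norm_nonneg v),
      smul_inv_smul₀ (norm_ne_zero_iff.2 hv)]
  rw [hscale, mul_comm b, mul_comm B, ENNReal.ofReal_mul (norm_nonneg v),
    ENNReal.ofReal_mul (norm_nonneg v)]
  exact ⟨mul_le_mul_right (h _ hunit).1 _, mul_le_mul_right (h _ hunit).2 _⟩

/-- The translates of `f` by the multiples of `L`, which are disjoint copies of `f` when `f`
vanishes outside `(0, L)`. -/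
def translates (f : ℝ → ℝ) (L : ℝ) (k : ℕ) (t : ℝ) : ℝ := f (t + -(k * L))

section translates

variable {f : ℝ → ℝ} {L : ℝ}

theorem translates_eq_zero_or (hf : ∀ t ∉ Ioo 0 L, f t = 0) {i j : ℕ} (hij : i ≠ j) (t : ℝ) :
    translates f L i t = 0 ∨ translates f L j t = 0 := by
  wlog hlt : i < j generalizing i j
  · exact (this hij.symm (by lia)).symm
  by_contra! hcon
  have hi : t + -(i * L) ∈ Ioo 0 L := by_contra fun h => hcon.1 (hf _ h)
  have hj : t + -(j * L) ∈ Ioo 0 L := by_contra fun h => hcon.2 (hf _ h)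
  have hle : ((i : ℝ) + 1) * L ≤ j * L :=
    mul_le_mul_of_nonneg_right (by exact_mod_cast hlt) (hi.1.trans hi.2).le
  linarith [hi.2, hj.1]

theorem distribFun_mul_translates (hf : ∀ t ∉ Ioo 0 L, f t = 0) (c : ℝ) (k : ℕ) :
    distribFun (fun t => c * translates f L k t) = distribFun fun t => c * f t := by
  funext τ
  have : {s : ℝ | 0 < s ∧ τ < ENNReal.ofReal |c * translates f L k s|} =
      (fun s => s + -(k * L)) ⁻¹' {s : ℝ | 0 < s ∧ τ < ENNReal.ofReal |c * f s|} := by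
    ext s
    simp only [mem_preimage, mem_ofPred_eq, translates, and_congr_left_iff]
    intro h
    have hs : s + -(k * L) ∈ Ioo 0 L := by
      by_contra hcon
      simp [hf _ hcon] at h
    have hL : 0 < L := hs.1.trans hs.2
    exact ⟨fun _ => hs.1, fun _ => by linarith [hs.1, show 0 ≤ k * L by positivity]⟩
  rw [distribFun, this, measure_preimage_add_right]
  rfl

theorem measurable_translates (hf : Measurable f) (k : ℕ) : Measurable (translates f L k) :=
  hf.comp (measurable_add_const _)

theorem lorentzNorm_sum_translates_rpow {q : ℝ} (hq : 0 < q) {ψ : ℝ → ℝ}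
    (hψ : MonotoneOn ψ (Ici 0)) (hfm : Measurable f) (hf : ∀ t ∉ Ioo 0 L, f t = 0) {n : ℕ}
    (c : Fin n → ℝ) : lorentzNorm q ψ hψ (fun t => ∑ k, c k * translates f L k t) ^ q =
      lorentzEnergy q ψ hψ fun τ => ∑ k, distribFun (fun t => c k * f t) τ := by
  have hdisj : ∀ i j : Fin n, i ≠ j →
      DisjointSupports (fun t => c i * translates f L i t) fun t => c j * translates f L j t :=
    fun i j hij => DisjointSupports.const_mul (Eventually.of_forall
      (translates_eq_zero_or hf (Fin.val_ne_of_ne hij))) _ _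
  rw [lorentzNorm_rpow hψ hq]
  congr 1
  funext τ
  rw [distribFun_sum (y := fun (k : Fin n) t => c k * translates f L k t)
    (fun k => ((measurable_translates hfm k).const_mul _).aemeasurable) hdisj]
  simp only [distribFun_mul_translates hf]

end translates

theorem exists_pos_rpow_bounds {q ε : ℝ} (hq : 0 < q) (hε : 0 < ε) :
    ∃ η > 0, (1 + ε)⁻¹ ^ q ≤ 1 - η ∧ 1 + η ≤ (1 + ε) ^ q := by
  have hx : 1 < (1 + ε) ^ q := Real.one_lt_rpow (by linarith) hq
  refine ⟨1 - (1 + ε)⁻¹ ^ q, ?_, by linarith, ?_⟩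
  · rw [Real.inv_rpow (by positivity)]
    exact sub_pos.2 (inv_lt_one_of_one_lt₀ hx)
  · rw [Real.inv_rpow (by positivity)]
    have hinv := mul_inv_cancel₀ (show (1 + ε) ^ q ≠ 0 by positivity)
    nlinarith [inv_lt_one_of_one_lt₀ hx]

theorem bounds_of_scaled_rpow_bounds {q ε η E r : ℝ} (hq : 0 < q) (hε : 0 < ε)
    (hlow : (1 + ε)⁻¹ ^ q ≤ 1 - η) (hupp : 1 + η ≤ (1 + ε) ^ q) (hr : 0 ≤ r) (hrE : r * E = 1)
    {N e : ℝ≥0∞} (hN : N ^ q = ENNReal.ofReal r * e)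
    (he : ENNReal.ofReal ((1 - η) * E) ≤ e ∧ e ≤ ENNReal.ofReal ((1 + η) * E)) :
    ENNReal.ofReal (1 + ε)⁻¹ ≤ N ∧ N ≤ ENNReal.ofReal (1 + ε) := by
  have hscale : ∀ s : ℝ, ENNReal.ofReal r * ENNReal.ofReal (s * E) = ENNReal.ofReal s := fun s => by
    rw [← ENNReal.ofReal_mul hr, mul_left_comm, hrE, mul_one]
  rw [← ENNReal.rpow_le_rpow_iff hq, ← ENNReal.rpow_le_rpow_iff (x := N) hq, hN,
    ENNReal.ofReal_rpow_of_pos (by positivity), ENNReal.ofReal_rpow_of_pos (by positivity)]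
  constructor
  · exact (ENNReal.ofReal_le_ofReal hlow).trans (hscale (1 - η) ▸ mul_le_mul_right he.1 _)
  · exact (hscale (1 + η) ▸ mul_le_mul_right he.2 _).trans (ENNReal.ofReal_le_ofReal hupp)

theorem symmFinitelyRepresented_of_lorentzEnergy {q : ℝ} (hq : 0 < q) {ψ : ℝ → ℝ}
    {hψ : MonotoneOn ψ (Ici 0)} {p : ℝ≥0∞} (hp : 1 ≤ p)
    (h : ∀ (n : ℕ) (η : ℝ), 0 < η → ∃ (f : ℝ → ℝ) (L E : ℝ), Measurable f ∧
      (∀ t ∉ Ioo 0 L, f t = 0) ∧ 0 < E ∧ ∀ c : PiLp p fun _ : Fin n => ℝ, ‖c‖ = 1 →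
        ENNReal.ofReal ((1 - η) * E) ≤
            lorentzEnergy q ψ hψ (fun τ => ∑ k, distribFun (fun t => c k * f t) τ) ∧
          lorentzEnergy q ψ hψ (fun τ => ∑ k, distribFun (fun t => c k * f t) τ) ≤
            ENNReal.ofReal ((1 + η) * E)) :
    SymmFinitelyRepresented (lorentzNorm q ψ hψ) p := by
  intro n ε hε
  have : Fact (1 ≤ p) := ⟨hp⟩
  obtain ⟨η, hη, hlow, hupp⟩ := exists_pos_rpow_bounds hq hε
  obtain ⟨f, L, E, hfm, hf, hE, hunit⟩ := h n η hη
  set r : ℝ := (E ^ q⁻¹)⁻¹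
  have hr : 0 < r := by positivity
  have hrE : r ^ q * E = 1 := by
    rw [Real.inv_rpow (by positivity), Real.rpow_inv_rpow hE.le hq.ne', inv_mul_cancel₀ hE.ne']
  set x : Fin n → ℝ → ℝ := fun k t => r * translates f L k t
  set N : (PiLp p fun _ : Fin n => ℝ) → ℝ≥0∞ := fun c =>
    lorentzNorm q ψ hψ fun t => ∑ k, c k * x k t
  have hN_smul : ∀ (s : ℝ) c, N (s • c) = ENNReal.ofReal |s| * N c := fun s c => by
    simp only [N, PiLp.smul_apply, smul_eq_mul, mul_assoc, ← Finset.mul_sum,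
      lorentzNorm_const_mul hq]
  have hN_rpow : ∀ c, N c ^ q = ENNReal.ofReal (r ^ q) *
      lorentzEnergy q ψ hψ (fun τ => ∑ k, distribFun (fun t => c k * f t) τ) := fun c => by
    simp only [N, x, mul_left_comm _ r, ← Finset.mul_sum]
    rw [lorentzNorm_const_mul hq, ENNReal.mul_rpow_of_nonneg _ _ hq.le, abs_of_pos hr,
      lorentzNorm_sum_translates_rpow hq hψ hfm hf, ENNReal.ofReal_rpow_of_pos hr]
  have hN_unit : ∀ c, ‖c‖ = 1 →
      ENNReal.ofReal (1 + ε)⁻¹ ≤ N c ∧ N c ≤ ENNReal.ofReal (1 + ε) := fun c hc =>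
    bounds_of_scaled_rpow_bounds hq hε hlow hupp (by positivity) hrE (hN_rpow c) (hunit c hc)
  have hbounds := bounds_of_homogeneous hN_smul hN_unit
  refine ⟨x, fun k => ⟨((measurable_translates hfm k).const_mul r).aemeasurable, ?_⟩,
    fun i j => equimeasurable_of_distribFun_eq (by simp only [x, distribFun_mul_translates hf]),
    fun i j hij => DisjointSupports.const_mul (Eventually.of_forall
      (translates_eq_zero_or hf (Fin.val_ne_of_ne hij))) _ _, fun a => hbounds _⟩
  have hsingle := (hbounds (WithLp.toLp p (Pi.single k 1))).2
  simp only [N, Pi.single_apply, ite_mul, one_mul, zero_mul, Finset.sum_ite_eq',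
    Finset.mem_univ, if_true] at hsingle
  exact hsingle.trans_lt ENNReal.ofReal_lt_top

/-! ### Sufficiency: indicator functions for `ℓ^∞` -/

theorem exists_le_mul_of_not_isSplitAt_zero {B : ℝ} {W : ℤ → ℝ} (hW : HasRatioBound B W)
    (hsplit : ¬IsSplitAt W 0) (N : ℕ) {η : ℝ} (hη : 0 < η) :
    ∃ k : ℤ, W (k + N) ≤ (1 + η) * W k := by
  by_contra! hgrowth
  have hN : 0 < N := Nat.pos_of_ne_zero fun h => by
    have := hgrowth 0
    rw [h, Nat.cast_zero, add_zero] at this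
    nlinarith [hW.pos 0]
  have hδ : 0 < Real.logb 2 (1 + η) / N :=
    div_pos (Real.logb_pos one_lt_two (by linarith)) (by exact_mod_cast hN)
  refine hsplit ⟨univ, ∅, fun k => Or.inl trivial, ⟨_, hδ, ?_⟩, 1, by norm_num, 1, one_pos, by simp⟩
  refine GrowsAtRate.of_step hW hN (fun k _ => trivial) fun k _ => ?_
  rw [div_mul_cancel₀ _ (by exact_mod_cast hN.ne'),
    Real.rpow_logb two_pos (by norm_num) (by positivity)]
  exact (hgrowth k).le

theorem distribFun_mul_indicator_one (c L : ℝ) (τ : ℝ≥0∞) :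
    distribFun (fun t => c * (Ioo 0 L).indicator 1 t) τ =
      if τ < ENNReal.ofReal |c| then ENNReal.ofReal L else 0 := by
  have hset : {s : ℝ | 0 < s ∧ τ < ENNReal.ofReal |c * (Ioo 0 L).indicator 1 s|} =
      if τ < ENNReal.ofReal |c| then Ioo 0 L else ∅ := by
    ext s
    by_cases hs : s ∈ Ioo 0 L
    · split_ifs with hτ <;> simp [hs, hs.1, hτ]
    · split_ifs <;> simp [hs]
  rw [distribFun, hset]
  split_ifs <;> simp

theorem lorentzEnergy_mono {q : ℝ} {ψ : ℝ → ℝ} (hψ : MonotoneOn ψ (Ici 0)) {H G : ℝ≥0∞ → ℝ≥0∞}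
    (h : ∀ τ, H τ ≤ G τ) : lorentzEnergy q ψ hψ H ≤ lorentzEnergy q ψ hψ G :=
  lintegral_mono fun _ => psiExt_mono hψ (h _)

theorem lorentzEnergy_ite_lt_one {q : ℝ} (hq : 0 < q) {ψ : ℝ → ℝ} (hψ : MonotoneOn ψ (Ici 0))
    (D : ℝ≥0∞) : lorentzEnergy q ψ hψ (fun τ => if τ < 1 then D else 0) = psiExt ψ hψ D := by
  have hindicator : ∀ s : ℝ, psiExt ψ hψ (if ENNReal.ofReal s ^ (1 / q) < 1 then D else 0) =
      (Iio 1).indicator (fun _ => psiExt ψ hψ D) s := fun s => by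
    have : ENNReal.ofReal s ^ (1 / q) < 1 ↔ s < 1 := by
      rw [one_div, ENNReal.rpow_inv_lt_iff hq, ENNReal.one_rpow, ENNReal.ofReal_lt_one]
    simp only [this, indicator, mem_Iio]
    split_ifs
    exacts [rfl, psiExt_zero hψ]
  simp only [lorentzEnergy, hindicator]
  rw [lintegral_indicator_const measurableSet_Iio, Measure.restrict_apply measurableSet_Iio,
    inter_comm, Ioi_inter_Iio, Real.volume_Ioo]
  simp

theorem IsLorentzWeight.symmFinitelyRepresented_top {q : ℝ} (hq : 0 < q) {ψ : ℝ → ℝ}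
    (hψ : IsLorentzWeight ψ) (hsplit : ¬IsSplitAt (dyadicValues ψ) 0) :
    SymmFinitelyRepresented (lorentzNorm q ψ hψ.monotoneOn) ∞ := by
  refine symmFinitelyRepresented_of_lorentzEnergy hq le_top fun n η hη => ?_
  obtain ⟨k, hk⟩ := exists_le_mul_of_not_isSplitAt_zero hψ.hasRatioBound hsplit n hη
  have hL : (0 : ℝ) < 2 ^ k := by positivity
  refine ⟨(Ioo 0 (2 ^ k)).indicator 1, 2 ^ k, ψ (2 ^ k), measurable_one.indicator measurableSet_Ioo,
    fun t ht => indicator_of_notMem ht _, hψ.pos _ hL, fun c hc => ?_⟩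
  simp only [distribFun_mul_indicator_one]
  have hle : ∀ i, |c i| ≤ 1 := fun i => hc ▸ PiLp.norm_apply_le c i
  obtain ⟨j, hj⟩ : ∃ j, |c j| = 1 := by
    rw [PiLp.norm_eq_ciSup] at hc
    rcases isEmpty_or_nonempty (Fin n) with hn | hn
    · simp at hc
    · exact (exists_eq_ciSup_of_finite (f := fun i => ‖c i‖)).imp fun j hj => hj.trans hc
  constructor
  · calc ENNReal.ofReal ((1 - η) * ψ (2 ^ k)) ≤ ENNReal.ofReal (ψ (2 ^ k)) :=
          ENNReal.ofReal_le_ofReal (by nlinarith [hψ.pos _ hL])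
      _ = lorentzEnergy q ψ hψ.monotoneOn fun τ => if τ < 1 then ENNReal.ofReal (2 ^ k) else 0 := by
          rw [lorentzEnergy_ite_lt_one hq, hψ.psiExt_ofReal hL.le]
      _ ≤ _ := lorentzEnergy_mono _ fun τ => by
          refine le_of_eq_of_le ?_ (Finset.single_le_sum (fun _ _ => zero_le) (Finset.mem_univ j))
          rw [hj, ENNReal.ofReal_one]
  · refine (lorentzEnergy_mono _ (G := fun τ => if τ < 1 then ENNReal.ofReal (2 ^ (k + n)) else 0)
      fun τ => ?_).trans ?_
    · split_ifs with hτ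
      · calc _ ≤ ∑ _ : Fin n, ENNReal.ofReal (2 ^ k) :=
              Finset.sum_le_sum fun i _ => by split_ifs <;> simp
          _ ≤ 2 ^ n * ENNReal.ofReal (2 ^ k) := by
              rw [Finset.sum_const, Finset.card_univ, Fintype.card_fin, nsmul_eq_mul]
              gcongr
              exact_mod_cast Nat.lt_two_pow_self.le
          _ = ENNReal.ofReal (2 ^ (k + n)) := by
              rw [two_pow_mul_ofReal, zpow_add₀ two_ne_zero, zpow_natCast, mul_comm]
      · refine (Finset.sum_eq_zero fun i _ => if_neg fun h => hτ (h.trans_le ?_)).le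
        exact ENNReal.ofReal_le_one.2 (hle i)
    · rw [lorentzEnergy_ite_lt_one hq, hψ.psiExt_ofReal (by positivity)]
      exact ENNReal.ofReal_le_ofReal hk

/-! ### Sufficiency: truncated powers for `ℓ^p`, `p < ∞` -/

namespace IsLorentzWeight

variable {ψ : ℝ → ℝ}

theorem map_add_le (hψ : IsLorentzWeight ψ) {s t : ℝ} (hs : 0 ≤ s) (ht : 0 ≤ t) :
    ψ (s + t) ≤ ψ s + ψ t := by
  rcases (add_nonneg hs ht).eq_or_lt with h | h
  · rw [← h, hψ.map_zero]
    exact add_nonneg (hψ.nonneg hs) (hψ.nonneg ht)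
  have hfraction : ∀ r, 0 ≤ r → r ≤ s + t → r / (s + t) * ψ (s + t) ≤ ψ r := fun r hr hrst => by
    rcases hr.eq_or_lt with rfl | hr
    · simp [hψ.map_zero]
    have := le_mul_of_concaveOn_of_zero hψ.concaveOn hψ.map_zero ((one_le_div hr).2 hrst) hr.le
    rwa [div_mul_cancel₀ _ hr.ne', ← inv_div, ← div_eq_inv_mul,
      le_div_iff₀' (by positivity)] at this
  calc ψ (s + t) = s / (s + t) * ψ (s + t) + t / (s + t) * ψ (s + t) := by field_simp
    _ ≤ ψ s + ψ t := add_le_add (hfraction s hs (by linarith)) (hfraction t ht (by linarith))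

theorem map_natCast_mul_le (hψ : IsLorentzWeight ψ) (n : ℕ) {t : ℝ} (ht : 0 ≤ t) :
    ψ (n * t) ≤ n * ψ t := by
  induction n with
  | zero => simp [hψ.map_zero]
  | succ n ih =>
    rw [Nat.cast_succ, add_one_mul, add_one_mul]
    linarith [hψ.map_add_le (mul_nonneg n.cast_nonneg ht) ht]

end IsLorentzWeight

/-- The power `t ^ (-1 / P)`, truncated at `M` and supported in `(0, L)`. -/
noncomputable def truncPower (P M L : ℝ) : ℝ → ℝ :=
  (Ioo 0 L).indicator fun t => (max t M) ^ (-P⁻¹)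

/-- The number `x` cut off at `L` from above and deleted up to `M`. Distribution functions of
truncated powers arise in this way from those of powers. -/
noncomputable def truncate (M L x : ℝ) : ℝ := if M < x then min L x else 0

theorem distribFun_mul_truncPower {P M : ℝ} (hP : 0 < P) (hM : 0 < M) (L c : ℝ) {τ : ℝ}
    (hτ : 0 < τ) : distribFun (fun t => c * truncPower P M L t) (ENNReal.ofReal τ) =
      ENNReal.ofReal (truncate M L ((|c| / τ) ^ P)) := by
  have hset : {s : ℝ | 0 < s ∧ ENNReal.ofReal τ < ENNReal.ofReal |c * truncPower P M L s|} =
      if M < (|c| / τ) ^ P then Ioo 0 (min L ((|c| / τ) ^ P)) else ∅ := by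
    ext s
    by_cases hs : s ∈ Ioo 0 L
    · have hmax : 0 < max s M := lt_max_of_lt_right hM
      have : τ < |c| * (max s M) ^ (-P⁻¹) ↔ s < (|c| / τ) ^ P ∧ M < (|c| / τ) ^ P := by
        rw [Real.rpow_neg hmax.le, ← div_eq_mul_inv, lt_div_comm₀ hτ (by positivity),
          Real.rpow_inv_lt_iff_of_pos hmax.le (by positivity) hP, max_lt_iff]
      simp only [mem_ofPred_eq, ENNReal.ofReal_lt_ofReal_iff_of_nonneg hτ.le, abs_mul, truncPower,
        indicator_of_mem hs, abs_of_pos (Real.rpow_pos_of_pos hmax _), this]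
      split_ifs with hc <;> simp [hs.1, hs.2, hc]
    · have hs' : s ∉ Ioo 0 (min L ((|c| / τ) ^ P)) := fun h =>
        hs ⟨h.1, h.2.trans_le (min_le_left _ _)⟩
      split_ifs <;> simp only [truncPower, indicator_of_notMem hs, hs', mem_ofPred_eq, mul_zero,
        abs_zero, ENNReal.ofReal_zero, not_lt_zero, and_false, mem_empty_iff_false]
  rw [distribFun, hset, truncate]
  split_ifs <;> simp

section truncate

variable {M L x : ℝ}

theorem truncate_nonneg (hM : 0 ≤ M) (hL : 0 ≤ L) : 0 ≤ truncate M L x := by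
  rw [truncate]
  split_ifs with h
  exacts [le_min hL (hM.trans h.le), le_rfl]

theorem truncate_le_self (hx : 0 ≤ x) : truncate M L x ≤ x := by
  rw [truncate]
  split_ifs
  exacts [min_le_right _ _, hx]

theorem truncate_le (hL : 0 ≤ L) : truncate M L x ≤ L := by
  rw [truncate]
  split_ifs
  exacts [min_le_left _ _, hL]

theorem truncate_of_le (hx : x ≤ M) : truncate M L x = 0 := if_neg hx.not_gt

theorem le_truncate_add (hM : 0 ≤ M) (hx : x ≤ L) : x ≤ truncate M L x + M := by
  rw [truncate]
  split_ifs with h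
  · rw [min_eq_right hx]
    linarith
  · linarith

variable {ι : Type*} [Fintype ι] {w : ι → ℝ} {u : ℝ}

theorem mul_le_of_sum_eq_one (hw : ∀ k, 0 ≤ w k) (hsum : ∑ k, w k = 1) (hu : 0 ≤ u) (k : ι) :
    w k * u ≤ u :=
  mul_le_of_le_one_left hu (hsum ▸ Finset.single_le_sum (fun i _ => hw i) (Finset.mem_univ k))

theorem sum_truncate_nonneg (hM : 0 ≤ M) (hL : 0 ≤ L) : 0 ≤ ∑ k, truncate M L (w k * u) :=
  Finset.sum_nonneg fun _ _ => truncate_nonneg hM hL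

theorem sum_truncate_le_self (hw : ∀ k, 0 ≤ w k) (hsum : ∑ k, w k = 1) (hu : 0 ≤ u) :
    ∑ k, truncate M L (w k * u) ≤ u := by
  calc _ ≤ ∑ k, w k * u := Finset.sum_le_sum fun k _ => truncate_le_self (mul_nonneg (hw k) hu)
    _ = u := by rw [← Finset.sum_mul, hsum, one_mul]

theorem sum_truncate_le_card_mul (hL : 0 ≤ L) :
    ∑ k, truncate M L (w k * u) ≤ Fintype.card ι * L := by
  simpa using Finset.sum_le_card_nsmul Finset.univ _ L fun k _ => truncate_le hL

theorem sum_truncate_eq_zero (hw : ∀ k, 0 ≤ w k) (hsum : ∑ k, w k = 1) (hu : 0 ≤ u)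
    (huM : u ≤ M) : ∑ k, truncate M L (w k * u) = 0 :=
  Finset.sum_eq_zero fun k _ => truncate_of_le ((mul_le_of_sum_eq_one hw hsum hu k).trans huM)

theorem le_sum_truncate_add (hM : 0 ≤ M) (hw : ∀ k, 0 ≤ w k) (hsum : ∑ k, w k = 1) (hu : 0 ≤ u)
    (huL : u ≤ L) : u ≤ ∑ k, truncate M L (w k * u) + Fintype.card ι * M := by
  calc u = ∑ k, w k * u := by rw [← Finset.sum_mul, hsum, one_mul]
    _ ≤ ∑ k, (truncate M L (w k * u) + M) := Finset.sum_le_sum fun k _ =>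
      le_truncate_add hM ((mul_le_of_sum_eq_one hw hsum hu k).trans huL)
    _ = _ := by simp [Finset.sum_add_distrib]

end truncate

section powerEnergy

variable {q γ M L : ℝ} {ψ : ℝ → ℝ} {ι : Type*} [Fintype ι]

theorem lorentzEnergy_sum_truncPower (hq : 0 < q) (hψ : IsLorentzWeight ψ) {P : ℝ} (hP : 0 < P)
    (hM : 0 < M) (hL : 0 ≤ L) (c : ι → ℝ) :
    lorentzEnergy q ψ hψ.monotoneOn
        (fun τ => ∑ k, distribFun (fun t => c k * truncPower P M L t) τ) =
      ∫⁻ s in Ioi (0 : ℝ), ENNReal.ofReal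
        (ψ (∑ k, truncate M L (|c k| ^ P * s ^ (-(q / P))⁻¹))) := by
  refine setLIntegral_congr_fun measurableSet_Ioi fun s (hs : 0 < s) => ?_
  have hscale : ∀ k, (|c k| / s ^ (1 / q)) ^ P = |c k| ^ P * s ^ (-(q / P))⁻¹ := fun k => by
    rw [Real.div_rpow (abs_nonneg _) (by positivity), ← Real.rpow_mul hs.le, div_eq_mul_inv,
      ← Real.rpow_neg hs.le]
    congr 2
    field_simp
  simp only [ENNReal.ofReal_rpow_of_pos hs, distribFun_mul_truncPower hP hM L _
    (Real.rpow_pos_of_pos hs _), hscale]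
  rw [← ENNReal.ofReal_sum_of_nonneg fun _ _ => truncate_nonneg hM.le hL,
    hψ.psiExt_ofReal (sum_truncate_nonneg hM.le hL)]

/-- The part of the Lorentz energy of the power `t ^ (-γ / q)` that comes from the values of its
distribution function between `M` and `L`. -/
noncomputable def powerEnergy (ψ : ℝ → ℝ) (γ M L : ℝ) : ℝ≥0∞ :=
  ∫⁻ s in Ico (L ^ (-γ)) (M ^ (-γ)), ENNReal.ofReal (ψ (s ^ (-γ)⁻¹))

theorem powerEnergy_ne_top (hψ : IsLorentzWeight ψ) (hγ : 0 < γ) (hL : 0 < L) :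
    powerEnergy ψ γ M L ≠ ∞ := by
  refine ne_top_of_le_ne_top ?_ (setLIntegral_mono' (g := fun _ => ENNReal.ofReal (ψ L))
    measurableSet_Ico fun s hs => ENNReal.ofReal_le_ofReal ?_)
  · rw [setLIntegral_const, Real.volume_Ico]
    exact ENNReal.mul_ne_top ENNReal.ofReal_ne_top ENNReal.ofReal_ne_top
  · have hs0 : 0 < s := (Real.rpow_pos_of_pos hL _).trans_le hs.1
    exact hψ.le_of_le (by positivity)
      ((Real.rpow_inv_le_iff_of_neg hs0 hL (neg_lt_zero.2 hγ)).2 hs.1)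

theorem lintegral_truncate_le (hψ : IsLorentzWeight ψ) (hγ : 0 < γ) (hM : 0 < M) (hL : 0 < L)
    {w : ι → ℝ} (hw : ∀ k, 0 ≤ w k) (hsum : ∑ k, w k = 1) :
    ∫⁻ s in Ioi (0 : ℝ), ENNReal.ofReal (ψ (∑ k, truncate M L (w k * s ^ (-γ)⁻¹))) ≤
      powerEnergy ψ γ M L + ENNReal.ofReal (Fintype.card ι * (L ^ (-γ) * ψ L)) := by
  set F : ℝ → ℝ := fun s => ∑ k, truncate M L (w k * s ^ (-γ)⁻¹)
  have hF0 : ∀ s, 0 ≤ F s := fun s => sum_truncate_nonneg hM.le hL.le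
  have hcover : Ioi (0 : ℝ) ⊆
      Ico (L ^ (-γ)) (M ^ (-γ)) ∪ (Ici (M ^ (-γ)) ∪ Ioo 0 (L ^ (-γ))) := fun s hs => by
    by_cases hsL : L ^ (-γ) ≤ s
    · exact (lt_or_ge s (M ^ (-γ))).imp (⟨hsL, ·⟩) Or.inl
    · exact Or.inr (Or.inr ⟨hs, not_le.1 hsL⟩)
  have hmiddle : ∫⁻ s in Ico (L ^ (-γ)) (M ^ (-γ)), ENNReal.ofReal (ψ (F s)) ≤
      powerEnergy ψ γ M L := by
    refine setLIntegral_mono' measurableSet_Ico fun s hs =>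
      ENNReal.ofReal_le_ofReal (hψ.le_of_le (hF0 s) ?_)
    have hs0 : 0 < s := (Real.rpow_pos_of_pos hL _).trans_le hs.1
    exact sum_truncate_le_self hw hsum (by positivity)
  have hright : ∫⁻ s in Ici (M ^ (-γ)), ENNReal.ofReal (ψ (F s)) = 0 := by
    refine setLIntegral_eq_zero measurableSet_Ici fun s (hs : M ^ (-γ) ≤ s) => ?_
    have hs0 : 0 < s := (Real.rpow_pos_of_pos hM _).trans_le hs
    have hu : s ^ (-γ)⁻¹ ≤ M := (Real.rpow_inv_le_iff_of_neg hs0 hM (neg_lt_zero.2 hγ)).2 hs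
    simp [show F s = 0 from sum_truncate_eq_zero hw hsum (by positivity) hu, hψ.map_zero]
  have hleft : ∫⁻ s in Ioo 0 (L ^ (-γ)), ENNReal.ofReal (ψ (F s)) ≤
      ENNReal.ofReal (Fintype.card ι * (L ^ (-γ) * ψ L)) := by
    refine (setLIntegral_mono' (g := fun _ => ENNReal.ofReal (Fintype.card ι * ψ L))
      measurableSet_Ioo fun s _ => ENNReal.ofReal_le_ofReal ?_).trans (le_of_eq ?_)
    · exact (hψ.le_of_le (hF0 s) (sum_truncate_le_card_mul hL.le)).trans
        (hψ.map_natCast_mul_le _ hL.le)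
    · rw [setLIntegral_const, Real.volume_Ioo, sub_zero, ← ENNReal.ofReal_mul
        (mul_nonneg (Nat.cast_nonneg _) (hψ.nonneg hL.le))]
      ring_nf
  calc _ ≤ _ := (lintegral_mono_set hcover).trans ((lintegral_union_le _ _ _).trans
        (add_le_add hmiddle (lintegral_union_le _ _ _)))
    _ ≤ _ := by
      rw [hright, zero_add]
      exact add_le_add_right hleft _

theorem powerEnergy_le_lintegral_truncate (hψ : IsLorentzWeight ψ) (hγ : 0 < γ) (hM : 0 < M)
    (hL : 0 < L) {w : ι → ℝ} (hw : ∀ k, 0 ≤ w k) (hsum : ∑ k, w k = 1) :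
    powerEnergy ψ γ M L ≤
      (∫⁻ s in Ioi (0 : ℝ), ENNReal.ofReal (ψ (∑ k, truncate M L (w k * s ^ (-γ)⁻¹)))) +
        ENNReal.ofReal (Fintype.card ι * (M ^ (-γ) * ψ M)) := by
  have hpointwise : ∀ s ∈ Ico (L ^ (-γ)) (M ^ (-γ)), ENNReal.ofReal (ψ (s ^ (-γ)⁻¹)) ≤
      ENNReal.ofReal (ψ (∑ k, truncate M L (w k * s ^ (-γ)⁻¹))) +
        ENNReal.ofReal (Fintype.card ι * ψ M) := fun s hs => by
    have hs0 : 0 < s := (Real.rpow_pos_of_pos hL _).trans_le hs.1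
    have hu : s ^ (-γ)⁻¹ ≤ L := (Real.rpow_inv_le_iff_of_neg hs0 hL (neg_lt_zero.2 hγ)).2 hs.1
    refine (ENNReal.ofReal_le_ofReal ?_).trans ENNReal.ofReal_add_le
    calc ψ (s ^ (-γ)⁻¹)
        ≤ ψ (∑ k, truncate M L (w k * s ^ (-γ)⁻¹) + Fintype.card ι * M) :=
          hψ.le_of_le (by positivity) (le_sum_truncate_add hM.le hw hsum (by positivity) hu)
      _ ≤ _ := (hψ.map_add_le (sum_truncate_nonneg hM.le hL.le) (by positivity)).trans
          (add_le_add_right (hψ.map_natCast_mul_le _ hM.le) _)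
  refine (setLIntegral_mono' measurableSet_Ico hpointwise).trans ?_
  rw [lintegral_add_right _ measurable_const, setLIntegral_const]
  refine add_le_add (lintegral_mono_set fun s hs => (Real.rpow_pos_of_pos hL _).trans_le hs.1) ?_
  rw [Real.volume_Ico, ← ENNReal.ofReal_mul (mul_nonneg (Nat.cast_nonneg _) (hψ.nonneg hM.le))]
  refine ENNReal.ofReal_le_ofReal ?_
  have : 0 ≤ L ^ (-γ) * (Fintype.card ι * ψ M) := by have := hψ.nonneg hM.le; positivity
  linarith

end powerEnergy

theorem tilt_dyadicValues (γ : ℝ) (ψ : ℝ → ℝ) (k : ℤ) :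
    tilt γ (dyadicValues ψ) k = ((2 : ℝ) ^ k) ^ (-γ) * ψ (2 ^ k) := by
  rw [tilt, dyadicValues, ← Real.rpow_intCast, ← Real.rpow_mul zero_le_two, mul_neg, mul_comm γ]

theorem mul_tilt_le_powerEnergy {γ : ℝ} {ψ : ℝ → ℝ} (hψ : IsLorentzWeight ψ) (hγ : 0 < γ) (k : ℤ) :
    ENNReal.ofReal ((1 - 2 ^ (-γ)) * tilt γ (dyadicValues ψ) k) ≤
      powerEnergy ψ γ (2 ^ k) (2 ^ (k + 1)) := by
  have hnext : ((2 : ℝ) ^ (k + 1)) ^ (-γ) = 2 ^ (-γ) * (2 ^ k) ^ (-γ) := by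
    rw [zpow_add_one₀ two_ne_zero, Real.mul_rpow (by positivity) zero_le_two, mul_comm]
  calc _ = ∫⁻ _ in Ico (((2 : ℝ) ^ (k + 1)) ^ (-γ)) ((2 ^ k) ^ (-γ)),
        ENNReal.ofReal (ψ (2 ^ k)) := by
        rw [setLIntegral_const, Real.volume_Ico, ← ENNReal.ofReal_mul (hψ.nonneg (by positivity)),
          hnext, tilt_dyadicValues]
        ring_nf
    _ ≤ _ := by
        refine setLIntegral_mono' measurableSet_Ico fun s hs =>
          ENNReal.ofReal_le_ofReal (hψ.le_of_le (by positivity) ?_)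
        have hs0 : 0 < s := (by positivity : (0 : ℝ) < _).trans_le hs.1
        exact ((Real.lt_rpow_inv_iff_of_neg (by positivity) hs0 (neg_lt_zero.2 hγ)).2 hs.2).le

theorem powerEnergy_add {γ M X L : ℝ} (ψ : ℝ → ℝ) (hγ : 0 ≤ γ) (hM : 0 < M) (hMX : M ≤ X)
    (hXL : X ≤ L) : powerEnergy ψ γ M X + powerEnergy ψ γ X L = powerEnergy ψ γ M L := by
  have hγ' : -γ ≤ 0 := neg_nonpos.2 hγ
  rw [powerEnergy, powerEnergy, powerEnergy, add_comm,
    ← lintegral_union measurableSet_Ico Ico_disjoint_Ico_same, Ico_union_Ico_eq_Ico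
      (Real.rpow_le_rpow_of_nonpos (hM.trans_le hMX) hXL hγ')
      (Real.rpow_le_rpow_of_nonpos hM hMX hγ')]

theorem mul_sum_tilt_le_powerEnergy {γ : ℝ} {ψ : ℝ → ℝ} (hψ : IsLorentzWeight ψ) (hγ : 0 < γ)
    {a b : ℤ} (hab : a ≤ b) :
    ENNReal.ofReal ((1 - 2 ^ (-γ)) * ∑ k ∈ Finset.Ico a b, tilt γ (dyadicValues ψ) k) ≤
      powerEnergy ψ γ (2 ^ a) (2 ^ b) := by
  induction b, hab using Int.leInduction with
  | base => simp
  | succ b hab ih =>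
    rw [← Finset.insert_Ico_right_eq_Ico_add_one hab, Finset.sum_insert Finset.right_notMem_Ico,
      mul_add, add_comm, ← powerEnergy_add ψ hγ.le (by positivity)
        (zpow_le_zpow_right₀ one_le_two hab) (zpow_le_zpow_right₀ one_le_two (by lia))]
    exact ENNReal.ofReal_add_le.trans (add_le_add ih (mul_tilt_le_powerEnergy hψ hγ b))

theorem exists_ends_le_mul_powerEnergy {γ : ℝ} {ψ : ℝ → ℝ} (hψ : IsLorentzWeight ψ) (hγ : 0 < γ)
    (hsplit : ¬IsSplitAt (dyadicValues ψ) γ) {ε : ℝ} (hε : 0 < ε) :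
    ∃ M L E : ℝ, 0 < M ∧ 0 < L ∧ 0 < E ∧ powerEnergy ψ γ M L = ENNReal.ofReal E ∧
      M ^ (-γ) * ψ M ≤ ε * E ∧ L ^ (-γ) * ψ L ≤ ε * E := by
  have hfac : 0 < 1 - (2 : ℝ) ^ (-γ) :=
    sub_pos.2 (Real.rpow_lt_one_of_one_lt_of_neg one_lt_two (neg_lt_zero.2 hγ))
  obtain ⟨a, b, hab, hends⟩ :=
    exists_ends_le_mul_sum_Ico hψ.hasRatioBound hsplit (mul_pos hε hfac)
  have hE := ENNReal.ofReal_toReal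
    (powerEnergy_ne_top (M := 2 ^ a) hψ hγ (show (0 : ℝ) < 2 ^ b by positivity))
  have hsum := mul_sum_tilt_le_powerEnergy hψ hγ hab
  rw [← hE, ENNReal.ofReal_le_ofReal_iff ENNReal.toReal_nonneg] at hsum
  have ha : 0 < tilt γ (dyadicValues ψ) a := (hψ.hasRatioBound.tilt γ).pos a
  have hb : 0 < tilt γ (dyadicValues ψ) b := (hψ.hasRatioBound.tilt γ).pos b
  have hends' := hends.trans_eq (mul_assoc _ _ _) |>.trans (mul_le_mul_of_nonneg_left hsum hε.le)
  refine ⟨2 ^ a, 2 ^ b, _, by positivity, by positivity, ?_, hE.symm, ?_, ?_⟩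
  · exact pos_of_mul_pos_right ((add_pos ha hb).trans_le hends') hε.le
  · rw [← tilt_dyadicValues]
    linarith
  · rw [← tilt_dyadicValues]
    linarith

theorem sum_abs_rpow_of_norm_eq_one {p : ℝ≥0∞} (hp : 0 < p.toReal) {ι : Type*} [Fintype ι]
    {c : PiLp p fun _ : ι => ℝ} (hc : ‖c‖ = 1) : ∑ k, |c k| ^ p.toReal = 1 := by
  rw [PiLp.norm_eq_sum hp, one_div, Real.rpow_inv_eq (Finset.sum_nonneg fun k _ => by positivity)
    zero_le_one hp.ne', Real.one_rpow] at hc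
  exact hc

theorem IsLorentzWeight.symmFinitelyRepresented_of_ne_top {q : ℝ} (hq : 0 < q) {ψ : ℝ → ℝ}
    (hψ : IsLorentzWeight ψ) {p : ℝ≥0∞} (hp : 1 ≤ p) (hp_top : p ≠ ∞)
    (hsplit : ¬IsSplitAt (dyadicValues ψ) (q / p.toReal)) :
    SymmFinitelyRepresented (lorentzNorm q ψ hψ.monotoneOn) p := by
  have hP : 0 < p.toReal := ENNReal.toReal_pos (by positivity) hp_top
  refine symmFinitelyRepresented_of_lorentzEnergy hq hp fun n η hη => ?_
  obtain ⟨M, L, E, hM, hL, hE, henergy, hendM, hendL⟩ :=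
    exists_ends_le_mul_powerEnergy hψ (div_pos hq hP) hsplit (ε := η / (n + 1)) (by positivity)
  have hsmall : ∀ {x : ℝ}, x ≤ η / (n + 1) * E → Fintype.card (Fin n) * x ≤ η * E := fun {x} hx =>
    calc (Fintype.card (Fin n) : ℝ) * x ≤ n * (η / (n + 1) * E) := by
          rw [Fintype.card_fin]
          gcongr
      _ = η * E * (n / (n + 1)) := by ring
      _ ≤ η * E := mul_le_of_le_one_right (by positivity)
          ((div_le_one (by positivity)).2 (by linarith))
  refine ⟨truncPower p.toReal M L, L, E, Measurable.indicator (by fun_prop) measurableSet_Ioo,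
    fun t ht => indicator_of_notMem ht _, hE, fun c hc => ?_⟩
  have hsum := sum_abs_rpow_of_norm_eq_one hP hc
  have hw : ∀ k, 0 ≤ |c k| ^ p.toReal := fun k => by positivity
  rw [lorentzEnergy_sum_truncPower hq hψ hP hM hL.le]
  constructor
  · rw [sub_mul, one_mul, ENNReal.ofReal_sub _ (by positivity), tsub_le_iff_right, ← henergy]
    exact (powerEnergy_le_lintegral_truncate hψ (div_pos hq hP) hM hL hw hsum).trans
      (add_le_add_right (ENNReal.ofReal_le_ofReal (hsmall hendM)) _)
  · rw [add_mul, one_mul, ENNReal.ofReal_add hE.le (by positivity), ← henergy]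
    exact (lintegral_truncate_le hψ (div_pos hq hP) hM hL hw hsum).trans
      (add_le_add_right (ENNReal.ofReal_le_ofReal (hsmall hendL)) _)

theorem IsLorentzWeight.symmFinitelyRepresented_iff_not_isSplitAt {q : ℝ} (hq : 0 < q) {ψ : ℝ → ℝ}
    (hψ : IsLorentzWeight ψ) {p : ℝ≥0∞} (hp : 1 ≤ p) :
    SymmFinitelyRepresented (lorentzNorm q ψ hψ.monotoneOn) p ↔
      ¬IsSplitAt (dyadicValues ψ) (q * (p⁻¹).toReal) := by
  refine ⟨hψ.not_isSplitAt_of_symmFinitelyRepresented hq hp, fun hsplit => ?_⟩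
  rcases eq_or_ne p ∞ with rfl | hp_top
  · exact hψ.symmFinitelyRepresented_top hq (by simpa using hsplit)
  · refine hψ.symmFinitelyRepresented_of_ne_top hq hp hp_top ?_
    rwa [div_eq_mul_inv, ← ENNReal.toReal_inv]

/-! ### The dilation indices as growth rates -/

namespace IsLorentzWeight

variable {q : ℝ} {ψ : ℝ → ℝ}

theorem tendsto_alphaSeq (hq : 0 < q) (hψ : IsLorentzWeight ψ) :
    Tendsto (alphaSeq q ψ) atTop (𝓝 (growthRate (dyadicValues ψ) univ / q)) := by
  refine (tendsto_growthRate_div hψ.hasRatioBound hq univ_nonempty fun _ _ => mem_univ _).congr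
    fun n => ?_
  rw [alphaSeq, Function.Surjective.iSup_congr (fun k : (univ : Set ℤ) => (k : ℤ))
    (fun k => ⟨⟨k, mem_univ k⟩, rfl⟩) fun k => ?_]
  simp only [dyadicValues, add_comm]

theorem tendsto_betaSeq (hq : 0 < q) (hψ : IsLorentzWeight ψ) :
    Tendsto (betaSeq q ψ) atTop (𝓝 (-(growthRate (reflect (dyadicValues ψ)) univ / q))) := by
  refine (tendsto_growthRate_div hψ.hasRatioBound.reflect hq univ_nonempty
    fun _ _ => mem_univ _).neg.congr fun n => ?_
  rw [neg_neg, betaSeq, Function.Surjective.iSup_congr (fun k : (univ : Set ℤ) => -(k + n : ℤ))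
    (fun k => ⟨⟨-k - n, mem_univ _⟩, by simp⟩) fun k => ?_]
  simp [reflect, dyadicValues]

theorem tendsto_alphaInfSeq (hq : 0 < q) (hψ : IsLorentzWeight ψ) :
    Tendsto (alphaInfSeq q ψ) atTop (𝓝 (growthRate (dyadicValues ψ) (Ici 0) / q)) :=
  (tendsto_growthRate_div hψ.hasRatioBound hq nonempty_Ici
    fun _ hk => (mem_Ici.1 hk).trans (by lia)).congr fun _ => rfl

theorem tendsto_betaZeroSeq (hq : 0 < q) (hψ : IsLorentzWeight ψ) :
    Tendsto (betaZeroSeq q ψ) atTop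
      (𝓝 (-(growthRate (reflect (dyadicValues ψ)) (Ici 0) / q))) := by
  refine (tendsto_growthRate_div hψ.hasRatioBound.reflect hq nonempty_Ici
    fun _ hk => (mem_Ici.1 hk).trans (by lia)).neg.congr fun n => ?_
  rw [neg_neg, betaZeroSeq, Function.Surjective.iSup_congr
    (fun k : Ici (0 : ℤ) => (⟨-k, neg_nonpos.2 k.2⟩ : {k : ℤ // k ≤ 0}))
    (fun k => ⟨⟨-k, neg_nonneg.2 k.2⟩, by simp⟩) fun k => ?_]
  simp [reflect, dyadicValues, sub_eq_add_neg, add_comm]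

theorem alphaIdx_eq (hq : 0 < q) (hψ : IsLorentzWeight ψ) :
    alphaIdx q ψ = growthRate (dyadicValues ψ) univ / q :=
  (hψ.tendsto_alphaSeq hq).limUnder_eq

theorem betaIdx_eq (hq : 0 < q) (hψ : IsLorentzWeight ψ) :
    betaIdx q ψ = -(growthRate (reflect (dyadicValues ψ)) univ / q) :=
  (hψ.tendsto_betaSeq hq).limUnder_eq

theorem alphaInfIdx_eq (hq : 0 < q) (hψ : IsLorentzWeight ψ) :
    alphaInfIdx q ψ = growthRate (dyadicValues ψ) (Ici 0) / q :=
  (hψ.tendsto_alphaInfSeq hq).limUnder_eq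

theorem betaZeroIdx_eq (hq : 0 < q) (hψ : IsLorentzWeight ψ) :
    betaZeroIdx q ψ = -(growthRate (reflect (dyadicValues ψ)) (Ici 0) / q) :=
  (hψ.tendsto_betaZeroSeq hq).limUnder_eq

theorem alphaIdx_nonneg (hq : 0 < q) (hψ : IsLorentzWeight ψ) : 0 ≤ alphaIdx q ψ := by
  rw [hψ.alphaIdx_eq hq]
  exact div_nonneg (growthRate_nonneg hψ.hasRatioBound univ_nonempty hψ.monotone_dyadicValues) hq.le

theorem antitone_reflect_dyadicValues (hψ : IsLorentzWeight ψ) :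
    Antitone (reflect (dyadicValues ψ)) := fun _ _ h =>
  hψ.monotone_dyadicValues (neg_le_neg h)

theorem betaZeroIdx_nonneg (hq : 0 < q) (hψ : IsLorentzWeight ψ) : 0 ≤ betaZeroIdx q ψ := by
  rw [hψ.betaZeroIdx_eq hq]
  exact neg_nonneg.2 (div_nonpos_of_nonpos_of_nonneg (growthRate_nonpos hψ.hasRatioBound.reflect
    nonempty_Ici hψ.antitone_reflect_dyadicValues) hq.le)

theorem alphaIdx_le_alphaInfIdx (hq : 0 < q) (hψ : IsLorentzWeight ψ) :
    alphaIdx q ψ ≤ alphaInfIdx q ψ := by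
  rw [hψ.alphaIdx_eq hq, hψ.alphaInfIdx_eq hq]
  exact div_le_div_of_nonneg_right
    (growthRate_anti hψ.hasRatioBound nonempty_Ici (subset_univ _)) hq.le

theorem betaZeroIdx_le_betaIdx (hq : 0 < q) (hψ : IsLorentzWeight ψ) :
    betaZeroIdx q ψ ≤ betaIdx q ψ := by
  rw [hψ.betaZeroIdx_eq hq, hψ.betaIdx_eq hq]
  exact neg_le_neg (div_le_div_of_nonneg_right
    (growthRate_anti hψ.hasRatioBound.reflect nonempty_Ici (subset_univ _)) hq.le)

theorem betaIdx_le_one_div (hq : 0 < q) (hψ : IsLorentzWeight ψ) : betaIdx q ψ ≤ 1 / q := by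
  have hrate := le_growthRate hψ.hasRatioBound.reflect univ_nonempty
    (GrowsAtRate.neg_logb hψ.hasRatioBound.reflect univ)
  rw [Real.logb_self_eq_one one_lt_two] at hrate
  rw [hψ.betaIdx_eq hq, ← neg_div]
  exact div_le_div_of_nonneg_right (neg_le.1 hrate) hq.le

theorem symmFinitelyRepresented_iff (hq : 0 < q) (hψ : IsLorentzWeight ψ) {p : ℝ≥0∞}
    (hp : 1 ≤ p) : SymmFinitelyRepresented (lorentzNorm q ψ hψ.monotoneOn) p ↔
      alphaIdx q ψ ≤ (p⁻¹).toReal ∧ (p⁻¹).toReal ≤ betaIdx q ψ ∧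
        ((p⁻¹).toReal ≤ betaZeroIdx q ψ ∨ alphaInfIdx q ψ ≤ (p⁻¹).toReal) := by
  rw [hψ.symmFinitelyRepresented_iff_not_isSplitAt hq hp, isSplitAt_iff hψ.hasRatioBound,
    hψ.alphaIdx_eq hq, hψ.betaIdx_eq hq, hψ.alphaInfIdx_eq hq, hψ.betaZeroIdx_eq hq]
  simp only [not_or, not_and_or, not_lt, le_neg, div_le_iff₀' hq, mul_neg]
  tauto

end IsLorentzWeight

theorem recipIdx_anti : Antitone recipIdx := fun _ _ h =>
  ENNReal.inv_le_inv.2 (ENNReal.ofReal_le_ofReal h)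

theorem one_le_recipIdx {a : ℝ} (ha : a ≤ 1) : 1 ≤ recipIdx a :=
  ENNReal.one_le_inv.2 (ENNReal.ofReal_le_one.2 ha)

theorem recipIdx_le_iff {p : ℝ≥0∞} (hp : p ≠ 0) {a : ℝ} (ha : 0 ≤ a) :
    recipIdx a ≤ p ↔ (p⁻¹).toReal ≤ a := by
  rw [recipIdx, ENNReal.inv_le_iff_inv_le,
    ENNReal.le_ofReal_iff_toReal_le (ENNReal.inv_ne_top.2 hp) ha]

theorem le_recipIdx_iff {p : ℝ≥0∞} (hp : p ≠ 0) {a : ℝ} :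
    p ≤ recipIdx a ↔ a ≤ (p⁻¹).toReal := by
  rw [recipIdx, ENNReal.le_inv_iff_le_inv,
    ENNReal.ofReal_le_iff_le_toReal (ENNReal.inv_ne_top.2 hp)]

theorem IsLorentzWeight.symmRepSet_eq {q : ℝ} (hq : 1 ≤ q) {ψ : ℝ → ℝ} (hψ : IsLorentzWeight ψ) :
    symmRepSet (lorentzNorm q ψ hψ.monotoneOn) =
      Icc (recipIdx (betaIdx q ψ)) (recipIdx (alphaIdx q ψ)) ∩
        (Ici (recipIdx (betaZeroIdx q ψ)) ∪ Iic (recipIdx (alphaInfIdx q ψ))) := by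
  have hq' : 0 < q := by linarith
  have hβ₀ := hψ.betaZeroIdx_nonneg hq'
  have hβ := hβ₀.trans (hψ.betaZeroIdx_le_betaIdx hq')
  ext p
  have hmem : 1 ≤ p → (SymmFinitelyRepresented (lorentzNorm q ψ hψ.monotoneOn) p ↔ p ∈
      Icc (recipIdx (betaIdx q ψ)) (recipIdx (alphaIdx q ψ)) ∩
        (Ici (recipIdx (betaZeroIdx q ψ)) ∪ Iic (recipIdx (alphaInfIdx q ψ)))) := fun hp => by
    have hp0 : p ≠ 0 := (zero_lt_one.trans_le hp).ne'
    rw [hψ.symmFinitelyRepresented_iff hq' hp, mem_inter_iff, mem_Icc, mem_union, mem_Ici, mem_Iic,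
      recipIdx_le_iff hp0 hβ, recipIdx_le_iff hp0 hβ₀, le_recipIdx_iff hp0, le_recipIdx_iff hp0]
    tauto
  refine ⟨fun h => (hmem h.1).1 h.2, fun h => ?_⟩
  have hp : 1 ≤ p := (one_le_recipIdx ((hψ.betaIdx_le_one_div hq').trans
    ((div_le_one hq').2 hq))).trans h.1.1
  exact ⟨hp, (hmem hp).2 h⟩

theorem mainTheorem5 (q : ℝ) (hq : 1 ≤ q) (ψ : ℝ → ℝ)
    (hmono : MonotoneOn ψ (Ici 0)) (hconc : ConcaveOn ℝ (Ici 0) ψ) (hzero : ψ 0 = 0)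
    (hpos : ∀ t : ℝ, 0 < t → 0 < ψ t) :
    -- the limits defining the indices exist and are nonnegative
    (Tendsto (alphaSeq q ψ) atTop (𝓝 (alphaIdx q ψ)) ∧
      Tendsto (betaSeq q ψ) atTop (𝓝 (betaIdx q ψ)) ∧
      Tendsto (alphaInfSeq q ψ) atTop (𝓝 (alphaInfIdx q ψ)) ∧
      Tendsto (betaZeroSeq q ψ) atTop (𝓝 (betaZeroIdx q ψ)) ∧
      0 ≤ alphaIdx q ψ ∧ 0 ≤ betaIdx q ψ ∧ 0 ≤ alphaInfIdx q ψ ∧ 0 ≤ betaZeroIdx q ψ) ∧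
    (alphaInfIdx q ψ ≤ betaZeroIdx q ψ →
      symmRepSet (lorentzNorm q ψ hmono) =
        Icc (recipIdx (betaIdx q ψ)) (recipIdx (alphaIdx q ψ))) ∧
    (betaZeroIdx q ψ < alphaInfIdx q ψ →
      symmRepSet (lorentzNorm q ψ hmono) =
        Icc (recipIdx (betaIdx q ψ)) (recipIdx (alphaInfIdx q ψ)) ∪
          Icc (recipIdx (betaZeroIdx q ψ)) (recipIdx (alphaIdx q ψ))) := by
  have hψ : IsLorentzWeight ψ := ⟨hmono, hconc, hzero, hpos⟩
  have hq' : 0 < q := by linarith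
  have hα_le := hψ.alphaIdx_le_alphaInfIdx hq'
  have hβ_le := hψ.betaZeroIdx_le_betaIdx hq'
  have hα := hψ.alphaIdx_nonneg hq'
  have hβ₀ := hψ.betaZeroIdx_nonneg hq'
  refine ⟨⟨tendsto_nhds_limUnder ⟨_, hψ.tendsto_alphaSeq hq'⟩,
    tendsto_nhds_limUnder ⟨_, hψ.tendsto_betaSeq hq'⟩,
    tendsto_nhds_limUnder ⟨_, hψ.tendsto_alphaInfSeq hq'⟩,
    tendsto_nhds_limUnder ⟨_, hψ.tendsto_betaZeroSeq hq'⟩,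
    hα, hβ₀.trans hβ_le, hα.trans hα_le, hβ₀⟩, fun hle => ?_, fun _ => ?_⟩
  · rw [hψ.symmRepSet_eq hq, union_comm, Iic_union_Ici_of_le (recipIdx_anti hle), inter_univ]
  · rw [hψ.symmRepSet_eq hq, inter_union_distrib_left, union_comm, ← Ici_inter_Iic,
      inter_assoc, Iic_inter_Iic, inf_eq_right.2 (recipIdx_anti hα_le), inter_right_comm,
      Ici_inter_Ici, sup_eq_right.2 (recipIdx_anti hβ_le), Ici_inter_Iic, Ici_inter_Iic]
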